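/- Let $\mathcal X,\mathcal Y$ be finite alphabets and $(x_i,y_i)_{i\ge 1}$ an iid source with joint law $p=p_{xy}$ whose marginals are strictly positive. All logarithms are to base 2, and $H(X|Y)$ is the conditional entropy of $p$. A rate-$R$ encoder with access to the side-information emits at each time $j=1,2,\dots$ a string of $\lfloor jR\rfloor-\lfloor (j-1)R\rfloor$ bits that is a function of $(x_1^j,y_1^j)$. A decoder of delay $\Delta$ estimates $x_i$ by some $\hat x_i(i+\Delta)$ that is a function of all bits emitted until time $i+\Delta$ and of $y_1^{i+\Delta}$. A family of codes, indexed by $\Delta$, achieves fixed-delay reliability $E\in[-\infty,\infty]$ if for every real $s<E$ there is $K<\infty$ with $\Pr(x_i\ne\hat x_i(i+\Delta))\le K2^{-\Delta s}$ for all $i\ge1$ and all integers $\Delta>0$. The reliability function at rate $R$ is the supremum of the achievable $E$. Put $$E^u_{si,b}(r)=\inf\{D(q\|p):\ q \text{ a law on } \mathcal X\times\mathcal Y,\ H(q_{x|y})\ge r\},\qquad E_{ei}(R)=\inf_{\alpha>0}\tfrac1\alpha E^u_{si,b}((1+\alpha)R),$$ $$E_0(\rho)=\log_2\sum_y\Big(\sum_x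 p(x,y)^{1/(1+\rho)}\Big)^{1+\rho},\qquad M=\max_y|\{x: p(x,y)>0\}|$$ (with $\inf\emptyset=\infty$). Then: (1) If $H(X|Y)<R<\log_2|\mathcal X|$, the reliability function at rate $R$ equals the source uncertainty-focusing bound $E_{ei}(R)$, and a family of codes achieves it. (2) For $H(X|Y)<R<\log_2 M$ there is a unique $\rho>0$ with $R=E_0(\rho)/\rho$, and then $E_{ei}(R)=E_0(\rho)$. For $R>H(X|Y)$ with $R\ge\log_2 M$, $E_{ei}(R)=\infty$. (3) If $E_0''(0)\ne0$, then $E_{ei}(H(X|Y))=0$, $E_{ei}$ is finite on some interval to the right of $H(X|Y)$, and its right derivative at $R=H(X|Y)$ is $2H(X|Y)/E_0''(0)>0$. If $E_0''(0)=0$, then both the reliability function and $E_{ei}$ are $0$ for $0\le R<H(X|Y)$ and $\infty$ for $R>H(X|Y)$. (4) The bound is asymptotically achieved by a universal fixed-to-variable block code smoothed by a FIFO queue. For a block-length $N$, the codeword of a block pair $(\vec x,\vec y)$ is a $1$, followed by the index of its joint type (written with $\lceil |\mathcal X||\mathcal Y|\log_2(N+1)\rceil$ bits), followed by the index of $\vec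 x$ among the blocks having that joint type with $\vec y$ (written with $\lceil N H(\vec x|\vec y)\rceil$ bits, $H(\vec x|\vec y)$ the empirical conditional entropy). Completed codewords enter a FIFO queue with an infinite buffer, which is drained at rate $R$; a $0$ is sent whenever the queue is empty. This encoder depends only on $\mathcal X,\mathcal Y,R,N$. For every $R$ there are decoders, one for each $N$ and $\Delta$, not depending on $p$, such that: (a) for every $p$ with $H(X|Y)<R<\log_2|\mathcal X|$ and every real $s<E_{ei}(R)$ there is $N_0$ such that for each block-length $N\ge N_0$ there is $K<\infty$ with $\Pr(x_i\ne\hat x_i(i+\Delta))\le K2^{-\Delta s}$ for all $i\ge1$, $\Delta>0$; and (b) for some block-lengths $N(\Delta)\to\infty$ with $N(\Delta)/\Delta\to0$, the resulting single family of codes achieves $E_{ei}(R)$ simultaneously for all $p$ with $H(X|Y)<R<\log_2|\mathcal X|$. -/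

import Mathlib

open scoped BigOperators Topology

noncomputable section

namespace SourceCoding

variable {X Y : Type*} [Fintype X] [Fintype Y]

/-! ### Information measures (all logarithms are to base 2) -/

/-- A joint law of (x, y) on the finite alphabets, with both marginals strictly positive. -/
def IsSource (p : X × Y → ℝ) : Prop :=
  p ∈ stdSimplex ℝ (X × Y) ∧ (∀ x, 0 < ∑ y, p (x, y)) ∧ (∀ y, 0 < ∑ x, p (x, y))

/-- The conditional entropy `H(q_{x|y})` in bits. -/
def condEntropy (q : X × Y → ℝ) : ℝ :=
  -∑ a : X × Y, q a * Real.logb 2 (q a / ∑ x, q (x, a.2))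

open Classical in
/-- The relative entropy `D(q‖p)` in bits; it is `⊤` unless `q ≪ p`. -/
def relEntropy (q p : X × Y → ℝ) : EReal :=
  if ∀ a, p a = 0 → q a = 0 then ((∑ a, q a * Real.logb 2 (q a / p a) : ℝ) : EReal) else ⊤

/-- The block exponent `E^u_{si,b}(r) = min {D(q‖p) : H(q_{x|y}) ≥ r}`, which is `⊤` when no
admissible `q` has finite divergence. -/
def blockExponent (p : X × Y → ℝ) (r : ℝ) : EReal :=
  ⨅ (q : X × Y → ℝ) (_ : q ∈ stdSimplex ℝ (X × Y)) (_ : r ≤ condEntropy q), relEntropy q p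

/-- The uncertainty-focusing bound `inf_{α > 0} (1/α) E^u_{si,b}((α+1)R)`. -/
def focusingBound (p : X × Y → ℝ) (R : ℝ) : EReal :=
  ⨅ (α : ℝ) (_ : 0 < α), ((1 / α : ℝ) : EReal) * blockExponent p ((α + 1) * R)

/-- The Gallager function `E₀(ρ)` of a source with side-information. -/
def gallager (p : X × Y → ℝ) (ρ : ℝ) : ℝ :=
  Real.logb 2 (∑ y, (∑ x, p (x, y) ^ (1 / (1 + ρ))) ^ (1 + ρ))

/-- The second derivative `E₀''(0)`. -/
def gallagerSecond (p : X × Y → ℝ) : ℝ := deriv (deriv (gallager p)) 0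

open Classical in
/-- `M(p) = max_y |{x : p(x, y) > 0}|`. -/
def maxSupport (p : X × Y → ℝ) : ℕ :=
  Finset.univ.sup fun y : Y => (Finset.univ.filter fun x : X => 0 < p (x, y)).card

/-! ### Fixed-rate encoders, fixed-delay decoders, reliability -/

/-- The number `⌊jR⌋ - ⌊(j-1)R⌋` of bits sent between time `j - 1` and time `j` (`j ≥ 1`). -/
def numBits (R : ℝ) (j : ℕ) : ℕ := ⌊(j : ℝ) * R⌋₊ - ⌊((j : ℝ) - 1) * R⌋₊

/-- A rate `R` encoder with access to the side-information: at each time `j = 1, 2, …` it maps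
`(x_1^j, y_1^j)` to the bits sent between time `j - 1` and time `j`. -/
abbrev Encoder (X Y : Type*) (R : ℝ) : Type _ :=
  (j : ℕ) → (Fin j → X) → (Fin j → Y) → (Fin (numBits R j) → Bool)

/-- All the bits emitted by the encoder until time `n`, in order. -/
def bitsUpTo {X Y : Type*} {R : ℝ} (e : Encoder X Y R) (n : ℕ) (x : Fin n → X) (y : Fin n → Y) :
    List Bool :=
  (List.finRange n).flatMap fun t => List.ofFn
    (e (t.1 + 1) (fun k => x (Fin.castLE t.2 k)) (fun k => y (Fin.castLE t.2 k)))

/-- A decoder of delay `Δ`. Source symbols are counted from `0` here: the `i`-th map estimates the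
symbol that enters at time `i + 1`, from the bits emitted until time `i + 1 + Δ` and the
side-information up to that time. -/
abbrev Decoder (X Y : Type*) (Δ : ℕ) : Type _ :=
  (i : ℕ) → List Bool → (Fin (i + 1 + Δ) → Y) → X

open Classical in
/-- The probability, under the iid law of the source, that the symbol number `i` (counted from
`0`) is decoded wrongly at its deadline. -/
def errorProb (p : X × Y → ℝ) {R : ℝ} {Δ : ℕ} (e : Encoder X Y R) (d : Decoder X Y Δ) (i : ℕ) :
    ℝ :=
  ∑ z : Fin (i + 1 + Δ) → X × Y,
    if d i (bitsUpTo e (i + 1 + Δ) (fun k => (z k).1) (fun k => (z k).2)) (fun k => (z k).2)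
        ≠ (z ⟨i, by omega⟩).1
    then ∏ k, p (z k) else 0

/-- The family (indexed by the delay) of rate `R` codes achieves fixed-delay reliability `E`:
for every real exponent `s < E` (that is `s = E - ε` when `E` is finite) the error probability is
at most `K 2^{-Δ s}`, uniformly over all source positions and all delays. -/
def Achieves (p : X × Y → ℝ) (R : ℝ) (e : ℕ → Encoder X Y R) (d : (Δ : ℕ) → Decoder X Y Δ)
    (E : EReal) : Prop :=
  ∀ s : ℝ, (s : EReal) < E → ∃ K : ℝ, ∀ i Δ : ℕ, 0 < Δ →
    errorProb p (e Δ) (d Δ) i ≤ K * (2 : ℝ) ^ (-(Δ : ℝ) * s)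

/-- Some family of rate `R` codes achieves fixed-delay reliability `E`. -/
def IsAchievable (p : X × Y → ℝ) (R : ℝ) (E : EReal) : Prop :=
  ∃ (e : ℕ → Encoder X Y R) (d : (Δ : ℕ) → Decoder X Y Δ), Achieves p R e d E

/-- The fixed-delay reliability function: the supremum of all achievable reliabilities. -/
def reliability (p : X × Y → ℝ) (R : ℝ) : EReal := sSup {E | IsAchievable p R E}

/-! ### The universal fixed-to-variable type code -/

/-- The `k` least significant binary digits of `n`. -/
def natBits (k n : ℕ) : List Bool := List.ofFn fun i : Fin k => n.testBit i

/-- The joint type of two blocks of length `N`, as the table of the numbers of occurrences. -/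
def jointType [DecidableEq X] [DecidableEq Y] {N : ℕ} (x : Fin N → X) (y : Fin N → Y) :
    X × Y → Fin (N + 1) :=
  fun a => ⟨(Finset.univ.filter fun k => (x k, y k) = a).card,
    Nat.lt_succ_of_le ((Finset.card_filter_le _ _).trans (by simp))⟩

/-- The empirical joint distribution of a joint type. -/
def empirical {N : ℕ} (t : X × Y → Fin (N + 1)) : X × Y → ℝ := fun a => ((t a : ℕ) : ℝ) / N

/-- The blocks that have joint type `t` with the block `y`. -/
def typeClass [DecidableEq X] [DecidableEq Y] {N : ℕ} (t : X × Y → Fin (N + 1)) (y : Fin N → Y) :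
    Finset (Fin N → X) :=
  Finset.univ.filter fun x => jointType x y = t

/-- The codeword of a block: a `1`, then the index of the joint type, written with a fixed number
of bits, then the index of the block `x` within its conditional type class given `y`, written with
`⌈N H(x|y)⌉` bits, `H(x|y)` being the empirical conditional entropy. -/
def typeCode [DecidableEq X] [DecidableEq Y] (N : ℕ) (x : Fin N → X) (y : Fin N → Y) :
    List Bool :=
  true ::
    (natBits (Nat.clog 2 ((N + 1) ^ (Fintype.card X * Fintype.card Y)))
        (Fintype.equivFin (X × Y → Fin (N + 1)) (jointType x y)) ++
      natBits ⌈(N : ℝ) * condEntropy (empirical (jointType x y))⌉₊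
        ((typeClass (jointType x y) y).equivFin ⟨x, by simp [typeClass]⟩))

/-! ### Smoothing through a FIFO queue with an infinite buffer -/

/-- What a block code of block-length `N` puts into the queue at time `j`: if a block has just been
completed, that is if `j` is a positive multiple of `N`, the codeword of that block. -/
def arrivals {X Y : Type*} {N : ℕ} (c : (Fin N → X) → (Fin N → Y) → List Bool) (j : ℕ)
    (x : Fin j → X) (y : Fin j → Y) : List Bool :=
  if h : 0 < j ∧ N ∣ j then
    c (fun k => x ⟨j - N + k, by have := Nat.le_of_dvd h.1 h.2; omega⟩)
      (fun k => y ⟨j - N + k, by have := Nat.le_of_dvd h.1 h.2; omega⟩)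
  else []

/-- The content of the queue just after time `j`: each time step first appends the new codeword
bits and then removes the `numBits R j` oldest bits (or all of them, if there are fewer). -/
def queue {X Y : Type*} {N : ℕ} (c : (Fin N → X) → (Fin N → Y) → List Bool) (R : ℝ) :
    (j : ℕ) → (Fin j → X) → (Fin j → Y) → List Bool
  | 0, _, _ => []
  | j + 1, x, y =>
      (queue c R j (fun k => x k.castSucc) (fun k => y k.castSucc) ++ arrivals c (j + 1) x y).drop
        (numBits R (j + 1))

/-- The rate `R` encoder that sends the bits in the order of the queue, and `0`s when the queue is
empty. -/
def fifoEncoder {X Y : Type*} {N : ℕ} (c : (Fin N → X) → (Fin N → Y) → List Bool) (R : ℝ) :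
    Encoder X Y R
  | 0, _, _ => fun _ => false
  | j + 1, x, y => fun m =>
      (queue c R j (fun k => x k.castSucc) (fun k => y k.castSucc) ++ arrivals c (j + 1) x y).getD
        m false

end SourceCoding

end

open SourceCoding

/-!
The reliability function equals the focusing bound because the exponent has a Legendre dual form.

**Duality.** For `ρ > -1` the Gallager function is `E₀(ρ) = max_q (ρ H(q_{x|y}) - D(q‖p))`, the
maximum being attained by the tilted law (`mul_condEntropy_sub_divergence_le`,
`gallager_eq_tilted`); both halves are Gibbs' inequality. If `H(q_{x|y}) ≥ (1 + α) R` this gives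
`D(q‖p) / α ≥ ρR` for every `ρ` with `E₀(ρ) ≤ ρR`, with equality for the tilted law at the `ρ` that
solves `R = E₀(ρ) / ρ` (`mul_le_focusingBound`, `focusingBound_gallager_div`). The ratio `E₀(ρ) / ρ`
increases from `H(X|Y)` to `log M`, so that this parametrises the bound between these two values;
above, every `ρ` qualifies and the bound is infinite. The slope at `H(X|Y)` is read off from the
expansion `E₀(ρ) = ρ H(X|Y) + ρ² E₀''(0) / 2 + o(ρ²)`. If some `q` dominated by `p` has a larger
conditional entropy than `p`, then moving `p` a little towards `q` shows that `E₀''(0) > 0`; hence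
`E₀''(0) = 0` forces `H(X|Y) = log M`, and the interval of finite exponents is empty.

**Achievability.** The queue found by successive blocks obeys Lindley's recursion
`W' = (W - service)⁺ + codeword length`. By the method of types the codeword length `ℓ` of the
universal code satisfies `E 2^{ρℓ} ≤ 2^{N (E₀(ρ) + o(1))}`, whereas a block is served about `NR`
bits. If `E₀(ρ) < ρR` and `N` is large, the recursion keeps `E 2^{ρW}` bounded
(`streamExpect_blockContent_le`), and Markov's inequality bounds the probability that a codeword is
still in the queue after the delay `Δ` by `2^{2ρNR} 2^{-ΔρR}` (`errorProb_fifo_le`). Once the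
codeword has left the queue it can be decoded, since the code is prefix-free given the
side-information (`eq_of_drained`). Every `s` below the focusing bound is below `ρR` for such a `ρ`
(`exists_gallager_lt_mul`), and a block-length `N = ⌊√Δ⌋` makes the factor `2^{2ρNR}` harmless.

**Converse.** Let `H(q_{x|y}) > (1 + α) R` and `Δ ≈ αn`. By the time `n + Δ` at which the first `n`
symbols have all been decoded, only about `(1 + α) n R` bits have been sent, too few to resolve the
typical blocks of `q`. So some of these symbols are wrong with high probability under `q`, hence
with probability about `2^{-n D(q‖p)} ≈ 2^{-Δ D(q‖p) / α}` under `p` (`le_of_isAchievable`).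
-/

noncomputable section

set_option linter.unusedSectionVars false

namespace SourceCoding

open Filter
open scoped BigOperators Topology

section

/-! ### Gibbs' inequality -/

lemma sub_div_log_two_le_mul_logb {q w : ℝ} (hq : 0 ≤ q) (hw : 0 ≤ w) (h : w = 0 → q = 0) :
    (q - w) / Real.log 2 ≤ q * Real.logb 2 (q / w) := by
  have h2 : 0 < Real.log 2 := Real.log_pos one_lt_two
  rcases hq.eq_or_lt with rfl | hq'
  · rw [zero_sub, zero_mul, neg_div]
    exact neg_nonpos.2 (div_nonneg hw h2.le)
  have hw' : 0 < w := hw.lt_of_ne fun h0 => hq'.ne' (h h0.symm)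
  rw [Real.logb, mul_div_assoc', div_le_div_iff_of_pos_right h2]
  have := Real.log_le_sub_one_of_pos (div_pos hw' hq')
  rw [← inv_div w q, Real.log_inv]
  have h3 : q * (w / q) = w := by field_simp
  nlinarith

lemma sub_div_log_two_lt_mul_logb {q w : ℝ} (hq : 0 ≤ q) (hw : 0 ≤ w) (h : w = 0 → q = 0)
    (hne : q ≠ w) : (q - w) / Real.log 2 < q * Real.logb 2 (q / w) := by
  have h2 : 0 < Real.log 2 := Real.log_pos one_lt_two
  rcases hq.eq_or_lt with rfl | hq'
  · have : 0 < w := hw.lt_of_ne hne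
    rw [zero_sub, zero_mul, neg_div]
    exact neg_neg_of_pos (div_pos this h2)
  have hw' : 0 < w := hw.lt_of_ne fun h0 => hq'.ne' (h h0.symm)
  rw [Real.logb, mul_div_assoc', div_lt_div_iff_of_pos_right h2]
  have := Real.log_lt_sub_one_of_pos (div_pos hw' hq') (by
    intro h1; rw [div_eq_one_iff_eq hq'.ne'] at h1; exact hne h1.symm)
  rw [← inv_div w q, Real.log_inv]
  have h3 : q * (w / q) = w := by field_simp
  nlinarith

/-- Gibbs' inequality, for unnormalised weights. -/
lemma gibbs {ι : Type*} [Fintype ι] {q w : ι → ℝ} (hq : ∀ a, 0 ≤ q a) (hw : ∀ a, 0 ≤ w a)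
    (h : ∀ a, w a = 0 → q a = 0) (hs : ∑ a, w a ≤ ∑ a, q a) :
    0 ≤ ∑ a, q a * Real.logb 2 (q a / w a) := by
  have h2 : 0 < Real.log 2 := Real.log_pos one_lt_two
  calc 0 ≤ (∑ a, q a - ∑ a, w a) / Real.log 2 := div_nonneg (by linarith) h2.le
    _ = ∑ a, (q a - w a) / Real.log 2 := by rw [← Finset.sum_sub_distrib, Finset.sum_div]
    _ ≤ _ := Finset.sum_le_sum fun a _ => sub_div_log_two_le_mul_logb (hq a) (hw a) (h a)

/-- The equality case of Gibbs' inequality. -/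
lemma eq_of_gibbs_le {ι : Type*} [Fintype ι] {q w : ι → ℝ} (hq : ∀ a, 0 ≤ q a)
    (hw : ∀ a, 0 ≤ w a) (h : ∀ a, w a = 0 → q a = 0) (hs : ∑ a, w a ≤ ∑ a, q a)
    (h0 : ∑ a, q a * Real.logb 2 (q a / w a) ≤ 0) : q = w := by
  have h2 : 0 < Real.log 2 := Real.log_pos one_lt_two
  by_contra hne
  obtain ⟨b, hb⟩ := Function.ne_iff.1 hne
  have : (∑ a, q a - ∑ a, w a) / Real.log 2 < ∑ a, q a * Real.logb 2 (q a / w a) := by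
    rw [← Finset.sum_sub_distrib, Finset.sum_div]
    exact Finset.sum_lt_sum
      (fun a _ => sub_div_log_two_le_mul_logb (hq a) (hw a) (h a))
      ⟨b, Finset.mem_univ _, sub_div_log_two_lt_mul_logb (hq b) (hw b) (h b) hb⟩
  have h3 : 0 ≤ (∑ a, q a - ∑ a, w a) / Real.log 2 := div_nonneg (by linarith) h2.le
  linarith

/-! ### Divergence and conditional entropy -/

variable {X Y : Type*} [Fintype X] [Fintype Y]

/-- The marginal law of the side-information. -/
def marginal (q : X × Y → ℝ) (y : Y) : ℝ := ∑ x, q (x, y)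

/-- The real value of the divergence `D(q‖p)` in bits, meaningful when `q ≪ p`. -/
def divergence (q p : X × Y → ℝ) : ℝ := ∑ a, q a * Real.logb 2 (q a / p a)

lemma relEntropy_of_ac {q p : X × Y → ℝ} (h : ∀ a, p a = 0 → q a = 0) :
    relEntropy q p = (divergence q p : EReal) := if_pos h

lemma marginal_nonneg {q : X × Y → ℝ} (hq : ∀ a, 0 ≤ q a) (y : Y) : 0 ≤ marginal q y :=
  Finset.sum_nonneg fun _ _ => hq _

lemma le_marginal {q : X × Y → ℝ} (hq : ∀ a, 0 ≤ q a) (a : X × Y) : q a ≤ marginal q a.2 :=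
  Finset.single_le_sum (f := fun x => q (x, a.2)) (fun _ _ => hq _) (Finset.mem_univ a.1)

lemma sum_marginal (q : X × Y → ℝ) : ∑ y, marginal q y = ∑ a, q a :=
  (Fintype.sum_prod_type_right _).symm

lemma sum_mul_snd (q : X × Y → ℝ) (f : Y → ℝ) :
    ∑ a : X × Y, q a * f a.2 = ∑ y, marginal q y * f y := by
  rw [Fintype.sum_prod_type_right]
  exact Finset.sum_congr rfl fun y _ => by rw [marginal, Finset.sum_mul]

lemma divergence_nonneg {q p : X × Y → ℝ} (hq : q ∈ stdSimplex ℝ (X × Y))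
    (hp : p ∈ stdSimplex ℝ (X × Y)) (h : ∀ a, p a = 0 → q a = 0) : 0 ≤ divergence q p :=
  gibbs hq.1 hp.1 h (by rw [hq.2, hp.2])

lemma divergence_self (p : X × Y → ℝ) : divergence p p = 0 := by
  refine Finset.sum_eq_zero fun a _ => ?_
  rcases eq_or_ne (p a) 0 with h | h <;> simp [h]

/-- The conditional entropy is the least expected code length `-log w(x|y)`. -/
lemma condEntropy_le {q : X × Y → ℝ} (hq : ∀ a, 0 ≤ q a) {w : X × Y → ℝ} (hw : ∀ a, 0 ≤ w a)
    (hw1 : ∀ y, ∑ x, w (x, y) ≤ 1) (h : ∀ a, w a = 0 → q a = 0) :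
    condEntropy q ≤ -∑ a, q a * Real.logb 2 (w a) := by
  have key := gibbs (q := q) (w := fun a => marginal q a.2 * w a) hq
    (fun a => mul_nonneg (marginal_nonneg hq _) (hw a))
    (fun a h0 => by
      rcases mul_eq_zero.1 h0 with h1 | h1
      · exact le_antisymm (h1 ▸ le_marginal hq a) (hq a)
      · exact h a h1)
    (by
      rw [← sum_marginal q, Fintype.sum_prod_type_right]
      refine Finset.sum_le_sum fun y _ => ?_
      dsimp only
      rw [← Finset.mul_sum]
      exact mul_le_of_le_one_right (marginal_nonneg hq y) (hw1 y))
  have : ∑ a, q a * Real.logb 2 (q a / (marginal q a.2 * w a)) =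
      ∑ a : X × Y, q a * Real.logb 2 (q a / ∑ x, q (x, a.2))
        - ∑ a, q a * Real.logb 2 (w a) := by
    rw [← Finset.sum_sub_distrib]
    refine Finset.sum_congr rfl fun a _ => ?_
    rcases eq_or_ne (q a) 0 with h0 | h0
    · simp [h0]
    have hm : marginal q a.2 ≠ 0 :=
      (((hq a).lt_of_ne h0.symm).trans_le (le_marginal hq a)).ne'
    have hwa : w a ≠ 0 := fun h1 => h0 (h a h1)
    rw [Real.logb_div h0 (mul_ne_zero hm hwa), Real.logb_mul hm hwa]
    change _ = q a * Real.logb 2 (q a / marginal q a.2) - _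
    rw [Real.logb_div h0 hm]
    ring
  unfold condEntropy
  linarith

lemma condEntropy_nonneg {q : X × Y → ℝ} (hq : ∀ a, 0 ≤ q a) : 0 ≤ condEntropy q := by
  unfold condEntropy
  rw [← Finset.sum_neg_distrib]
  refine Finset.sum_nonneg fun a _ => ?_
  have h := le_marginal hq a
  have h2 : Real.logb 2 (q a / marginal q a.2) ≤ 0 :=
    Real.logb_nonpos one_lt_two (div_nonneg (hq a) (marginal_nonneg hq _))
      (div_le_one_of_le₀ h (marginal_nonneg hq _))
  have := mul_nonpos_of_nonneg_of_nonpos (hq a) h2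
  exact neg_nonneg.2 this

lemma condEntropy_concave {q₀ q₁ : X × Y → ℝ} (h₀ : ∀ a, 0 ≤ q₀ a) (h₁ : ∀ a, 0 ≤ q₁ a)
    {t : ℝ} (ht : 0 < t) (ht1 : t < 1) :
    (1 - t) * condEntropy q₀ + t * condEntropy q₁ ≤
      condEntropy (fun a => (1 - t) * q₀ a + t * q₁ a) := by
  set r : X × Y → ℝ := fun a => (1 - t) * q₀ a + t * q₁ a with hr
  have hs : 0 < 1 - t := by linarith
  have hr0 : ∀ a, 0 ≤ r a := fun a =>
    add_nonneg (mul_nonneg hs.le (h₀ a)) (mul_nonneg ht.le (h₁ a))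
  have hz : ∀ a, r a = 0 → q₀ a = 0 ∧ q₁ a = 0 := fun a h => by
    have := (add_eq_zero_iff_of_nonneg (mul_nonneg hs.le (h₀ a)) (mul_nonneg ht.le (h₁ a))).1 h
    exact ⟨(mul_eq_zero.1 this.1).resolve_left hs.ne', (mul_eq_zero.1 this.2).resolve_left ht.ne'⟩
  have hw : ∀ a : X × Y, 0 ≤ r a / marginal r a.2 := fun a =>
    div_nonneg (hr0 a) (marginal_nonneg hr0 _)
  have hw1 : ∀ y, ∑ x, r (x, y) / marginal r y ≤ 1 := fun y => by
    rw [← Finset.sum_div]; exact div_self_le_one _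
  have hwz : ∀ a : X × Y, r a / marginal r a.2 = 0 → r a = 0 := fun a h => by
    rcases div_eq_zero_iff.1 h with h | h
    · exact h
    · exact le_antisymm (h ▸ le_marginal hr0 a) (hr0 a)
  have e₀ := condEntropy_le h₀ hw hw1 fun a h => (hz a (hwz a h)).1
  have e₁ := condEntropy_le h₁ hw hw1 fun a h => (hz a (hwz a h)).2
  have : condEntropy r = (1 - t) * (-∑ a, q₀ a * Real.logb 2 (r a / marginal r a.2))
      + t * (-∑ a, q₁ a * Real.logb 2 (r a / marginal r a.2)) := by
    unfold condEntropy
    rw [mul_neg, mul_neg, ← neg_add, Finset.mul_sum, Finset.mul_sum, ← Finset.sum_add_distrib]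
    congr 1
    refine Finset.sum_congr rfl fun a _ => ?_
    change r a * Real.logb 2 (r a / marginal r a.2) = _
    simp only [hr]; ring
  rw [this]
  exact add_le_add (mul_le_mul_of_nonneg_left e₀ hs.le) (mul_le_mul_of_nonneg_left e₁ ht.le)

/-! ### Supports -/

lemma IsSource.marginal_pos {p : X × Y → ℝ} (hp : IsSource p) (y : Y) : 0 < marginal p y :=
  hp.2.2 y

open Classical in
/-- The number of symbols `x` that are possible together with `y`. -/
def supportCard (p : X × Y → ℝ) (y : Y) : ℕ := (Finset.univ.filter fun x : X => 0 < p (x, y)).card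

lemma supportCard_le (p : X × Y → ℝ) (y : Y) : supportCard p y ≤ maxSupport p :=
  Finset.le_sup (f := fun y : Y => supportCard p y) (Finset.mem_univ y)

lemma exists_supportCard [Nonempty Y] (p : X × Y → ℝ) : ∃ y, supportCard p y = maxSupport p := by
  obtain ⟨y, _, hy⟩ := Finset.exists_mem_eq_sup Finset.univ Finset.univ_nonempty
    (fun y : Y => supportCard p y)
  exact ⟨y, hy.symm⟩

lemma IsSource.supportCard_pos {p : X × Y → ℝ} (hp : IsSource p) (y : Y) :
    0 < supportCard p y := by
  rw [supportCard, Finset.card_pos]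
  by_contra h
  rw [Finset.not_nonempty_iff_eq_empty, Finset.filter_eq_empty_iff] at h
  exact (hp.2.2 y).not_ge (Finset.sum_nonpos fun x hx => not_lt.1 (h hx))

lemma condEntropy_le_logb_maxSupport {p q : X × Y → ℝ} (hp : IsSource p)
    (hq : q ∈ stdSimplex ℝ (X × Y)) (h : ∀ a, p a = 0 → q a = 0) :
    condEntropy q ≤ Real.logb 2 (maxSupport p) := by
  classical
  have e := condEntropy_le hq.1
    (w := fun a => if 0 < p a then ((supportCard p a.2 : ℝ))⁻¹ else 0)
    (fun a => by split_ifs <;> positivity)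
    (fun y => by
      dsimp only
      rw [← Finset.sum_filter, Finset.sum_const, nsmul_eq_mul]
      change (supportCard p y : ℝ) * _ ≤ 1
      exact mul_inv_le_one)
    (fun a ha => by
      by_contra h0
      have hpa : 0 < p a := (hp.1.1 a).lt_of_ne fun h1 => h0 (h a h1.symm)
      rw [if_pos hpa, inv_eq_zero] at ha
      exact (hp.supportCard_pos a.2).ne' (by exact_mod_cast ha))
  refine e.trans ?_
  rw [← Finset.sum_neg_distrib]
  calc ∑ a, -(q a * Real.logb 2 (if 0 < p a then ((supportCard p a.2 : ℝ))⁻¹ else 0))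
      ≤ ∑ a, q a * Real.logb 2 (maxSupport p) := by
        refine Finset.sum_le_sum fun a _ => ?_
        rcases eq_or_ne (q a) 0 with h0 | h0
        · simp [h0]
        have hpa : 0 < p a := (hp.1.1 a).lt_of_ne fun h1 => h0 (h a h1.symm)
        rw [if_pos hpa, Real.logb_inv, mul_neg, neg_neg]
        refine mul_le_mul_of_nonneg_left ?_ (hq.1 a)
        exact Real.logb_le_logb_of_le one_lt_two (by exact_mod_cast hp.supportCard_pos a.2)
          (by exact_mod_cast supportCard_le p a.2)
    _ = _ := by rw [← Finset.sum_mul, hq.2, one_mul]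

/-- The largest conditional entropy of a law dominated by `p` is attained by the uniform law on
a largest fibre of the support of `p`. -/
lemma exists_condEntropy_eq_logb_maxSupport [Nonempty Y] {p : X × Y → ℝ} (hp : IsSource p) :
    ∃ q ∈ stdSimplex ℝ (X × Y), (∀ a, p a = 0 → q a = 0) ∧
      condEntropy q = Real.logb 2 (maxSupport p) := by
  classical
  obtain ⟨y₀, hy₀⟩ := exists_supportCard p
  have hM : (maxSupport p : ℝ) ≠ 0 := by
    rw [← hy₀]; exact_mod_cast (hp.supportCard_pos y₀).ne'
  set q : X × Y → ℝ := fun a => if a.2 = y₀ ∧ 0 < p a then (maxSupport p : ℝ)⁻¹ else 0 with hqd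
  have hm : marginal q y₀ = 1 := by
    simp only [marginal, hqd, true_and]
    rw [← Finset.sum_filter, Finset.sum_const, nsmul_eq_mul]
    change (supportCard p y₀ : ℝ) * _ = 1
    rw [hy₀, mul_inv_cancel₀ hM]
  have hq : q ∈ stdSimplex ℝ (X × Y) := by
    refine ⟨fun a => by simp only [hqd]; split_ifs <;> positivity, ?_⟩
    rw [← sum_marginal, Finset.sum_eq_single y₀, hm]
    · intro y _ hy; simp [marginal, hqd, hy]
    · simp
  refine ⟨q, hq, fun a ha => by simp [hqd, ha], ?_⟩
  have : ∀ a, q a * Real.logb 2 (q a / ∑ x, q (x, a.2)) =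
      q a * -Real.logb 2 (maxSupport p) := fun a => by
    by_cases h : a.2 = y₀ ∧ 0 < p a
    · have h1 : ∑ x, q (x, a.2) = 1 := by rw [h.1]; exact hm
      rw [h1, div_one, ← Real.logb_inv]
      simp only [hqd, if_pos h]
    · have : q a = 0 := by simp only [hqd, if_neg h]
      simp [this]
  unfold condEntropy
  rw [Finset.sum_congr rfl fun a _ => this a, ← Finset.sum_mul, hq.2]
  ring

/-! ### The Gallager function as a Legendre transform -/

/-- The weight `p(x,y)^{1/(1+ρ)}`. -/
def tiltWeight (p : X × Y → ℝ) (ρ : ℝ) (a : X × Y) : ℝ := p a ^ (1 / (1 + ρ))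

/-- The normalisation `∑_y (∑_x p(x,y)^{1/(1+ρ)})^{1+ρ} = 2^{E₀(ρ)}`. -/
def partitionSum (p : X × Y → ℝ) (ρ : ℝ) : ℝ := ∑ y, marginal (tiltWeight p ρ) y ^ (1 + ρ)

/-- The tilted law, which attains the maximum of `ρ H(q_{x|y}) - D(q‖p)` over `q`. -/
def tilted (p : X × Y → ℝ) (ρ : ℝ) (a : X × Y) : ℝ :=
  tiltWeight p ρ a / marginal (tiltWeight p ρ) a.2 *
    (marginal (tiltWeight p ρ) a.2 ^ (1 + ρ) / partitionSum p ρ)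

lemma gallager_eq (p : X × Y → ℝ) (ρ : ℝ) : gallager p ρ = Real.logb 2 (partitionSum p ρ) := rfl

section Tilted

variable {p : X × Y → ℝ} {ρ : ℝ}

lemma tiltWeight_nonneg (hp : IsSource p) (a : X × Y) : 0 ≤ tiltWeight p ρ a :=
  Real.rpow_nonneg (hp.1.1 a) _

lemma tiltWeight_eq_zero (hp : IsSource p) (hρ : -1 < ρ) {a : X × Y} :
    tiltWeight p ρ a = 0 ↔ p a = 0 := by
  have : 1 / (1 + ρ) ≠ 0 := by
    have : 0 < 1 + ρ := by linarith
    positivity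
  rw [tiltWeight, Real.rpow_eq_zero (hp.1.1 a) this]

lemma marginal_tiltWeight_pos (hp : IsSource p) (hρ : -1 < ρ) (y : Y) :
    0 < marginal (tiltWeight p ρ) y := by
  have h : 0 < marginal p y := hp.2.2 y
  obtain ⟨x, _, hx⟩ := (Finset.sum_pos_iff_of_nonneg fun x _ => hp.1.1 (x, y)).1 h
  refine (Finset.sum_pos_iff_of_nonneg fun x _ => tiltWeight_nonneg hp _).2
    ⟨x, Finset.mem_univ _, (tiltWeight_nonneg hp _).lt_of_ne fun h0 => ?_⟩
  exact hx.ne' ((tiltWeight_eq_zero hp hρ).1 h0.symm)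

variable [Nonempty Y]

lemma partitionSum_pos (hp : IsSource p) (hρ : -1 < ρ) : 0 < partitionSum p ρ :=
  Finset.sum_pos (fun y _ => Real.rpow_pos_of_pos (marginal_tiltWeight_pos hp hρ y) _)
    Finset.univ_nonempty

lemma marginal_tilted (hp : IsSource p) (hρ : -1 < ρ) (y : Y) : marginal (tilted p ρ) y =
    marginal (tiltWeight p ρ) y ^ (1 + ρ) / partitionSum p ρ := by
  have h := (marginal_tiltWeight_pos hp hρ y).ne'
  conv_lhs => unfold marginal tilted
  dsimp only
  rw [← Finset.sum_mul, ← Finset.sum_div]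
  change marginal (tiltWeight p ρ) y / _ * _ = _
  rw [div_self h, one_mul]

lemma tilted_mem (hp : IsSource p) (hρ : -1 < ρ) : tilted p ρ ∈ stdSimplex ℝ (X × Y) := by
  have hZ := partitionSum_pos hp hρ
  refine ⟨fun a => ?_, ?_⟩
  · exact mul_nonneg (div_nonneg (tiltWeight_nonneg hp _) (marginal_tiltWeight_pos hp hρ _).le)
      (div_nonneg (Real.rpow_nonneg (marginal_tiltWeight_pos hp hρ _).le _) hZ.le)
  · rw [← sum_marginal, Finset.sum_congr rfl fun y _ => marginal_tilted hp hρ y, ← Finset.sum_div]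
    exact div_self hZ.ne'

lemma tilted_eq_zero (hp : IsSource p) (hρ : -1 < ρ) {a : X × Y} (h : p a = 0) :
    tilted p ρ a = 0 := by
  simp [tilted, (tiltWeight_eq_zero hp hρ).2 h]

lemma divergence_sub_condEntropy_add_gallager (hp : IsSource p) (hρ : -1 < ρ) {q : X × Y → ℝ}
    (hq : q ∈ stdSimplex ℝ (X × Y)) (h : ∀ a, p a = 0 → q a = 0) :
    divergence q p - ρ * condEntropy q + gallager p ρ =
      (1 + ρ) * ∑ a, q a * Real.logb 2 (q a /
          (marginal q a.2 * (tiltWeight p ρ a / marginal (tiltWeight p ρ) a.2))) +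
        ∑ y, marginal q y * Real.logb 2 (marginal q y /
          (marginal (tiltWeight p ρ) y ^ (1 + ρ) / partitionSum p ρ)) := by
  have hZ := partitionSum_pos hp hρ
  have hZ1 : gallager p ρ = ∑ a, q a * gallager p ρ := by rw [← Finset.sum_mul, hq.2, one_mul]
  rw [← sum_mul_snd q fun y => Real.logb 2 (marginal q y /
          (marginal (tiltWeight p ρ) y ^ (1 + ρ) / partitionSum p ρ)), hZ1]
  unfold divergence condEntropy
  rw [mul_neg, sub_neg_eq_add, Finset.mul_sum, Finset.mul_sum, ← Finset.sum_add_distrib,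
    ← Finset.sum_add_distrib, ← Finset.sum_add_distrib]
  refine Finset.sum_congr rfl fun a _ => ?_
  change q a * Real.logb 2 (q a / p a) + ρ * (q a * Real.logb 2 (q a / marginal q a.2)) + _ = _
  rcases eq_or_ne (q a) 0 with h0 | h0
  · simp [h0]
  have hpa : p a ≠ 0 := fun h1 => h0 (h a h1)
  have hm : marginal q a.2 ≠ 0 :=
    (((hq.1 a).lt_of_ne h0.symm).trans_le (le_marginal hq.1 a)).ne'
  have hw : tiltWeight p ρ a ≠ 0 := fun h1 => hpa ((tiltWeight_eq_zero hp hρ).1 h1)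
  have hS := marginal_tiltWeight_pos hp hρ a.2
  have hρ1 : 1 + ρ ≠ 0 := by linarith
  have hlw : Real.logb 2 (tiltWeight p ρ a) = 1 / (1 + ρ) * Real.logb 2 (p a) := by
    rw [tiltWeight, Real.logb_rpow_eq_mul_logb_of_pos ((hp.1.1 a).lt_of_ne hpa.symm)]
  rw [Real.logb_div h0 hpa, Real.logb_div h0 hm, Real.logb_div h0 (by positivity),
    Real.logb_mul hm (by positivity), Real.logb_div hw hS.ne', Real.logb_div hm (by positivity),
    Real.logb_div (by positivity) hZ.ne', Real.logb_rpow_eq_mul_logb_of_pos hS, hlw, gallager_eq]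
  field_simp
  ring

/-- One half of the Legendre duality `E₀(ρ) = max_q (ρ H(q_{x|y}) - D(q‖p))`. -/
lemma mul_condEntropy_sub_divergence_le (hp : IsSource p) (hρ : -1 < ρ) {q : X × Y → ℝ}
    (hq : q ∈ stdSimplex ℝ (X × Y)) (h : ∀ a, p a = 0 → q a = 0) :
    ρ * condEntropy q - divergence q p ≤ gallager p ρ := by
  have e := divergence_sub_condEntropy_add_gallager hp hρ hq h
  have hZ := partitionSum_pos hp hρ
  have hS := marginal_tiltWeight_pos hp hρ
  have g1 : 0 ≤ ∑ a, q a * Real.logb 2 (q a /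
      (marginal q a.2 * (tiltWeight p ρ a / marginal (tiltWeight p ρ) a.2))) := by
    refine gibbs hq.1 (fun a => mul_nonneg (marginal_nonneg hq.1 _)
      (div_nonneg (tiltWeight_nonneg hp _) (hS _).le)) (fun a h0 => ?_) ?_
    · rcases mul_eq_zero.1 h0 with h1 | h1
      · exact le_antisymm (h1 ▸ le_marginal hq.1 a) (hq.1 a)
      · exact h a ((tiltWeight_eq_zero hp hρ).1
          ((div_eq_zero_iff.1 h1).resolve_right (hS _).ne'))
    · rw [← sum_marginal q, Fintype.sum_prod_type_right]
      refine Finset.sum_le_sum fun y _ => ?_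
      dsimp only
      rw [← Finset.mul_sum, ← Finset.sum_div]
      exact mul_le_of_le_one_right (marginal_nonneg hq.1 y) (div_self_le_one _)
  have g2 : 0 ≤ ∑ y, marginal q y * Real.logb 2 (marginal q y /
      (marginal (tiltWeight p ρ) y ^ (1 + ρ) / partitionSum p ρ)) := by
    refine gibbs (marginal_nonneg hq.1)
      (fun y => div_nonneg (Real.rpow_nonneg (hS y).le _) hZ.le) (fun y h0 => ?_) ?_
    · have := hS y
      exact absurd h0 (by positivity)
    · rw [sum_marginal, hq.2, ← Finset.sum_div]
      exact div_self_le_one _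
  have : 0 ≤ (1 + ρ) * ∑ a, q a * Real.logb 2 (q a /
      (marginal q a.2 * (tiltWeight p ρ a / marginal (tiltWeight p ρ) a.2))) :=
    mul_nonneg (by linarith) g1
  linarith

/-- The other half of the Legendre duality: the tilted law attains the maximum. -/
lemma gallager_eq_tilted (hp : IsSource p) (hρ : -1 < ρ) :
    gallager p ρ = ρ * condEntropy (tilted p ρ) - divergence (tilted p ρ) p := by
  have e := divergence_sub_condEntropy_add_gallager hp hρ (tilted_mem hp hρ)
    fun a => tilted_eq_zero hp hρ
  have hZ := partitionSum_pos hp hρ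
  have hS := marginal_tiltWeight_pos hp hρ
  rw [Finset.sum_eq_zero, Finset.sum_eq_zero] at e
  · linarith
  · intro y _
    rw [marginal_tilted hp hρ]
    have := hS y
    rw [div_self (by positivity)]
    simp
  · intro a _
    rw [marginal_tilted hp hρ, mul_comm (_ / partitionSum p ρ)]
    change tilted p ρ a * Real.logb 2 (tilted p ρ a / tilted p ρ a) = 0
    rcases eq_or_ne (tilted p ρ a) 0 with h | h
    · simp [h]
    · simp [div_self h]

lemma mul_condEntropy_le_gallager (hp : IsSource p) (hρ : -1 < ρ) :
    ρ * condEntropy p ≤ gallager p ρ := by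
  simpa [divergence_self] using mul_condEntropy_sub_divergence_le hp hρ hp.1 fun a h => h

lemma gallager_le_mul_condEntropy_tilted (hp : IsSource p) (hρ : -1 < ρ) :
    gallager p ρ ≤ ρ * condEntropy (tilted p ρ) := by
  have := divergence_nonneg (tilted_mem hp hρ) hp.1 fun a => tilted_eq_zero hp hρ
  rw [gallager_eq_tilted hp hρ]
  linarith

/-- If `E₀(ρ)` exceeds `ρ H(X|Y)` then the tilted law differs from `p`, so that its divergence is
positive and `E₀(ρ) < ρ H(q_ρ)`. -/
lemma gallager_lt_mul_condEntropy_tilted (hp : IsSource p) (hρ : -1 < ρ)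
    (h : ρ * condEntropy p < gallager p ρ) :
    gallager p ρ < ρ * condEntropy (tilted p ρ) := by
  by_contra hcon
  have e := gallager_eq_tilted hp hρ
  have hm := tilted_mem hp hρ
  have : tilted p ρ = p := eq_of_gibbs_le hm.1 hp.1.1 (fun a => tilted_eq_zero hp hρ)
    (by rw [hm.2, hp.1.2]) (by change divergence (tilted p ρ) p ≤ 0; linarith)
  rw [this, divergence_self] at e
  linarith

lemma gallager_zero (hp : IsSource p) : gallager p 0 = 0 := by
  have h : partitionSum p 0 = 1 := by
    simp only [partitionSum, add_zero, Real.rpow_one, sum_marginal, tiltWeight, div_one]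
    exact hp.1.2
  rw [gallager_eq, h, Real.logb_one]

/-- The ratio `E₀(ρ)/ρ` is strictly increasing as soon as it exceeds the conditional entropy. -/
lemma gallager_div_lt_gallager_div (hp : IsSource p) {ρ₁ ρ₂ : ℝ} (h₁ : 0 < ρ₁) (h₂ : ρ₁ < ρ₂)
    (h : condEntropy p < gallager p ρ₁ / ρ₁) : gallager p ρ₁ / ρ₁ < gallager p ρ₂ / ρ₂ := by
  have hm : -1 < ρ₁ := by linarith
  rw [lt_div_iff₀ h₁, mul_comm] at h
  have e := gallager_eq_tilted hp hm
  have l := gallager_lt_mul_condEntropy_tilted hp hm h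
  have v := mul_condEntropy_sub_divergence_le hp (ρ := ρ₂) (by linarith) (tilted_mem hp hm)
    fun a => tilted_eq_zero hp hm
  rw [div_lt_div_iff₀ h₁ (h₁.trans h₂)]
  have : 0 < (ρ₂ - ρ₁) * (ρ₁ * condEntropy (tilted p ρ₁) - gallager p ρ₁) :=
    mul_pos (by linarith) (by linarith)
  nlinarith

lemma gallager_le_mul_logb_maxSupport (hp : IsSource p) (hρ : 0 < ρ) :
    gallager p ρ ≤ ρ * Real.logb 2 (maxSupport p) :=
  (gallager_le_mul_condEntropy_tilted hp (by linarith)).trans <| mul_le_mul_of_nonneg_left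
    (condEntropy_le_logb_maxSupport hp (tilted_mem hp (by linarith))
      fun a => tilted_eq_zero hp (by linarith)) hρ.le

/-- At or above `log M`, the line of slope `R > H(X|Y)` lies strictly above `E₀`. -/
lemma gallager_lt_mul_of_logb_maxSupport_le (hp : IsSource p) {R : ℝ} (hR : condEntropy p < R)
    (hM : Real.logb 2 (maxSupport p) ≤ R) (hρ : 0 < ρ) : gallager p ρ < ρ * R := by
  have hle : ρ * condEntropy (tilted p ρ) ≤ ρ * R := mul_le_mul_of_nonneg_left
    ((condEntropy_le_logb_maxSupport hp (tilted_mem hp (by linarith))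
      fun a => tilted_eq_zero hp (by linarith)).trans hM) hρ.le
  rcases le_or_gt (gallager p ρ) (ρ * condEntropy p) with h | h
  · exact h.trans_lt (mul_lt_mul_of_pos_left hR hρ)
  · exact (gallager_lt_mul_condEntropy_tilted hp (by linarith) h).trans_le hle

end Tilted

end

section

variable {X Y : Type*} [Fintype X] [Fintype Y] [Nonempty Y] {p : X × Y → ℝ}

/-! ### Smoothness of the Gallager function -/

lemma contDiffAt_tiltWeight (hp : IsSource p) {ρ : ℝ} (hρ : -1 < ρ) (a : X × Y) :
    ContDiffAt ℝ 2 (fun ρ => tiltWeight p ρ a) ρ := by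
  rcases eq_or_ne (p a) 0 with h | h
  · refine (contDiffAt_const (c := (0 : ℝ))).congr_of_eventuallyEq ?_
    filter_upwards [lt_mem_nhds hρ] with σ hσ
    exact (tiltWeight_eq_zero hp hσ).2 h
  · have : (1 : ℝ) + ρ ≠ 0 := by linarith
    exact ContDiffAt.rpow contDiffAt_const
      (contDiffAt_const.div (contDiffAt_const.add contDiffAt_id) this) h

lemma contDiffAt_gallager (hp : IsSource p) {ρ : ℝ} (hρ : -1 < ρ) :
    ContDiffAt ℝ 2 (gallager p) ρ := by
  have hZ : ContDiffAt ℝ 2 (partitionSum p) ρ :=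
    ContDiffAt.sum fun y _ => ContDiffAt.rpow
      (ContDiffAt.sum fun x _ => contDiffAt_tiltWeight hp hρ (x, y))
      (contDiffAt_const.add contDiffAt_id) (marginal_tiltWeight_pos hp hρ y).ne'
  exact (hZ.log (partitionSum_pos hp hρ).ne').div_const _

lemma hasDerivAt_gallager_zero (hp : IsSource p) : HasDerivAt (gallager p) (condEntropy p) 0 := by
  have hd : DifferentiableAt ℝ (gallager p) 0 :=
    (contDiffAt_gallager hp (by norm_num)).differentiableAt (by norm_num)
  have h1 : HasDerivAt (fun ρ => gallager p ρ - ρ * condEntropy p)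
      (deriv (gallager p) 0 - 1 * condEntropy p) 0 :=
    hd.hasDerivAt.sub ((hasDerivAt_id (0 : ℝ)).mul_const _)
  -- `E₀(ρ) - ρ H(X|Y)` is minimal at `ρ = 0`
  have hmin : IsLocalMin (fun ρ => gallager p ρ - ρ * condEntropy p) 0 := by
    filter_upwards [lt_mem_nhds (show (-1 : ℝ) < 0 by norm_num)] with ρ hρ
    have := mul_condEntropy_le_gallager hp hρ
    rw [gallager_zero hp]
    linarith
  have h0 := hmin.hasDerivAt_eq_zero h1
  have : deriv (gallager p) 0 = condEntropy p := by linarith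
  exact this ▸ hd.hasDerivAt

lemma tendsto_gallager_div (hp : IsSource p) :
    Tendsto (fun ρ => gallager p ρ / ρ) (𝓝[>] 0) (𝓝 (condEntropy p)) := by
  have h := (hasDerivAt_iff_tendsto_slope.1 (hasDerivAt_gallager_zero hp)).mono_left
    (nhdsWithin_mono 0 (fun x (hx : 0 < x) => hx.ne'))
  refine h.congr fun ρ => ?_
  rw [slope_def_field, gallager_zero hp, sub_zero, sub_zero]

/-- The second-order expansion of `E₀` at `0`. -/
lemma tendsto_gallager_second (hp : IsSource p) :
    Tendsto (fun ρ => (gallager p ρ - ρ * condEntropy p) / ρ ^ 2) (𝓝[>] 0)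
      (𝓝 (gallagerSecond p / 2)) := by
  have hm : (-1 : ℝ) < 0 := by norm_num
  have hd2 : DifferentiableAt ℝ (deriv (gallager p)) 0 := by
    have h1 : ContDiffAt ℝ 1 (deriv (gallager p)) 0 := by
      have := (contDiffAt_gallager hp hm).fderiv_right (m := 1) (by norm_num)
      exact this.clm_apply contDiffAt_const
    exact h1.differentiableAt (by norm_num)
  have e0 := (hasDerivAt_gallager_zero hp).deriv
  refine HasDerivAt.lhopital_zero_nhdsGT (f' := fun ρ => deriv (gallager p) ρ - condEntropy p)
    (g' := fun ρ => 2 * ρ) ?_ ?_ ?_ ?_ ?_ ?_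
  · filter_upwards [self_mem_nhdsWithin] with ρ hρ
    have hd : DifferentiableAt ℝ (gallager p) ρ :=
      (contDiffAt_gallager hp (hm.trans hρ)).differentiableAt (by norm_num)
    have e := hd.hasDerivAt.sub ((hasDerivAt_id ρ).mul_const (condEntropy p))
    rw [one_mul] at e
    exact e
  · exact Eventually.of_forall fun ρ => by simpa using hasDerivAt_pow 2 ρ
  · filter_upwards [self_mem_nhdsWithin] with ρ hρ
    exact mul_ne_zero two_ne_zero (ne_of_gt hρ)
  · have hc : ContinuousAt (fun ρ => gallager p ρ - ρ * condEntropy p) 0 :=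
      (contDiffAt_gallager hp hm).continuousAt.sub (by fun_prop)
    have := hc.tendsto.mono_left (nhdsWithin_le_nhds (s := Set.Ioi 0))
    simpa [gallager_zero hp] using this
  · have hc : ContinuousAt (fun ρ : ℝ => ρ ^ 2) 0 := by fun_prop
    simpa using hc.tendsto.mono_left (nhdsWithin_le_nhds (s := Set.Ioi 0))
  · have h := (hasDerivAt_iff_tendsto_slope.1 hd2.hasDerivAt).mono_left
      (nhdsWithin_mono 0 (fun x (hx : 0 < x) => hx.ne'))
    refine (h.div_const 2).congr fun ρ => ?_
    rw [slope_def_field, e0, sub_zero, div_div, mul_comm ρ 2]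

lemma gallagerSecond_nonneg (hp : IsSource p) : 0 ≤ gallagerSecond p := by
  have h : 0 ≤ gallagerSecond p / 2 := by
    refine ge_of_tendsto (tendsto_gallager_second hp) ?_
    filter_upwards [self_mem_nhdsWithin] with ρ (hρ : 0 < ρ)
    have := mul_condEntropy_le_gallager hp (ρ := ρ) (by linarith)
    exact div_nonneg (by linarith) (by positivity)
  linarith

/-- The divergence is bounded by the `χ²`-distance. -/
lemma divergence_le_chiSq {q : X × Y → ℝ} (hp : p ∈ stdSimplex ℝ (X × Y))
    (hq : q ∈ stdSimplex ℝ (X × Y)) (h : ∀ a, p a = 0 → q a = 0) :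
    divergence q p ≤ (∑ a, (q a - p a) ^ 2 / p a) / Real.log 2 := by
  have h2 : 0 < Real.log 2 := Real.log_pos one_lt_two
  have : (∑ a, (q a - p a) ^ 2 / p a) = ∑ a, ((q a - p a) ^ 2 / p a + (q a - p a)) := by
    rw [Finset.sum_add_distrib, Finset.sum_sub_distrib, hp.2, hq.2]; ring
  rw [this, Finset.sum_div]
  refine Finset.sum_le_sum fun a _ => ?_
  rcases eq_or_ne (p a) 0 with h0 | h0
  · simp [h0, h a h0]
  have hpa : 0 < p a := (hp.1 a).lt_of_ne h0.symm
  rw [Real.logb, mul_div_assoc', div_le_div_iff_of_pos_right h2]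
  rcases (hq.1 a).eq_or_lt with h1 | h1
  · rw [← h1]
    have : (0 - p a) ^ 2 / p a = p a := by field_simp; ring
    rw [this]; simp
  have hl := Real.log_le_sub_one_of_pos (div_pos h1 hpa)
  calc q a * Real.log (q a / p a) ≤ q a * (q a / p a - 1) := mul_le_mul_of_nonneg_left hl h1.le
    _ = _ := by field_simp; ring

/-- If some law dominated by `p` has a larger conditional entropy than `p`, then `E₀''(0) > 0`:
moving `p` a distance `t` towards it costs a divergence of order `t²` only, while the conditional
entropy gains a term of order `t`. -/
lemma gallagerSecond_pos_of_condEntropy_lt (hp : IsSource p) {q : X × Y → ℝ}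
    (hq : q ∈ stdSimplex ℝ (X × Y)) (h : ∀ a, p a = 0 → q a = 0)
    (hlt : condEntropy p < condEntropy q) : 0 < gallagerSecond p := by
  set c := condEntropy q - condEntropy p with hc
  have hc0 : 0 < c := sub_pos.2 hlt
  have h2 : 0 < Real.log 2 := Real.log_pos one_lt_two
  set χ := (∑ a, (q a - p a) ^ 2 / p a) / Real.log 2 with hχ
  have hχ0 : 0 ≤ χ := div_nonneg (Finset.sum_nonneg fun a _ =>
    div_nonneg (sq_nonneg _) (hp.1.1 a)) h2.le
  set C := χ + 1 with hC
  have hC0 : 0 < C := by linarith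
  have hlim : c ^ 2 / (4 * C) ≤ gallagerSecond p / 2 := by
    refine ge_of_tendsto (tendsto_gallager_second hp) ?_
    have hsmall : ∀ᶠ ρ in 𝓝[>] (0 : ℝ), ρ < 2 * C / c :=
      nhdsWithin_le_nhds (gt_mem_nhds (by positivity))
    filter_upwards [self_mem_nhdsWithin, hsmall] with ρ (hρ : 0 < ρ) hρ2
    set t := ρ * c / (2 * C) with ht
    have ht0 : 0 < t := by positivity
    have ht1 : t < 1 := by
      rw [ht, div_lt_one (by positivity)]
      rwa [lt_div_iff₀ hc0] at hρ2
    set r : X × Y → ℝ := fun a => (1 - t) * p a + t * q a with hr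
    have hrm : r ∈ stdSimplex ℝ (X × Y) := by
      have := convex_stdSimplex ℝ (X × Y) hp.1 hq (a := 1 - t) (b := t) (by linarith) ht0.le
        (by ring)
      exact this
    have hrz : ∀ a, p a = 0 → r a = 0 := fun a h0 => by simp [hr, h0, h a h0]
    have v := mul_condEntropy_sub_divergence_le hp (ρ := ρ) (by linarith) hrm hrz
    have hH := condEntropy_concave hp.1.1 hq.1 ht0 ht1
    have hD : divergence r p ≤ t ^ 2 * C := by
      refine (divergence_le_chiSq hp.1 hrm hrz).trans ?_
      have : (∑ a, (r a - p a) ^ 2 / p a) / Real.log 2 = t ^ 2 * χ := by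
        rw [hχ, mul_div_assoc', Finset.mul_sum]
        congr 1
        refine Finset.sum_congr rfl fun a _ => ?_
        simp only [hr]; ring
      rw [this]
      exact mul_le_mul_of_nonneg_left (by linarith) (sq_nonneg _)
    rw [le_div_iff₀ (by positivity)]
    have e1 : ρ * (condEntropy p + t * c) ≤ ρ * condEntropy r :=
      mul_le_mul_of_nonneg_left (by rw [hc]; linarith) hρ.le
    have e2 : ρ * (t * c) - t ^ 2 * C = c ^ 2 / (4 * C) * ρ ^ 2 := by
      rw [ht]; field_simp; ring
    linarith
  have : 0 < c ^ 2 / (4 * C) := by positivity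
  linarith

lemma condEntropy_eq_of_gallagerSecond_eq_zero (hp : IsSource p) (h0 : gallagerSecond p = 0) :
    condEntropy p = Real.logb 2 (maxSupport p) := by
  refine le_antisymm (condEntropy_le_logb_maxSupport hp hp.1 fun a h => h) ?_
  obtain ⟨q, hq, hqp, hH⟩ := exists_condEntropy_eq_logb_maxSupport hp
  rw [← hH]
  by_contra hlt
  exact (gallagerSecond_pos_of_condEntropy_lt hp hq hqp (not_le.1 hlt)).ne' h0

lemma condEntropy_lt_gallager_div (hp : IsSource p) (h : 0 < gallagerSecond p) {ρ : ℝ}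
    (hρ : 0 < ρ) : condEntropy p < gallager p ρ / ρ := by
  have hev : ∀ᶠ σ in 𝓝[>] (0 : ℝ), 0 < (gallager p σ - σ * condEntropy p) / σ ^ 2 :=
    (tendsto_gallager_second hp).eventually (lt_mem_nhds (by linarith))
  have hsmall : ∀ᶠ σ in 𝓝[>] (0 : ℝ), σ < ρ := nhdsWithin_le_nhds (gt_mem_nhds hρ)
  obtain ⟨σ, ⟨h1, h2⟩, h3 : 0 < σ⟩ := ((hev.and hsmall).and self_mem_nhdsWithin).exists
  have h4 : 0 < gallager p σ - σ * condEntropy p := by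
    have : 0 < σ ^ 2 := by positivity
    exact (div_pos_iff_of_pos_right this).1 h1
  have h5 : condEntropy p < gallager p σ / σ := by
    rw [lt_div_iff₀ h3]; linarith
  exact h5.trans (gallager_div_lt_gallager_div hp h3 h2 h5)

/-- If `H(X|Y) = 0` then `x` is a function of `y` on the support of `p`, hence also under every
dominated law, so that `E₀ ≤ 0`. -/
lemma condEntropy_pos_of_gallagerSecond_pos (hp : IsSource p) (h : 0 < gallagerSecond p) :
    0 < condEntropy p := by
  refine (condEntropy_nonneg hp.1.1).lt_of_ne fun h0 => ?_
  have hterm : ∀ a : X × Y, p a ≠ 0 → p a = marginal p a.2 := by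
    intro a ha
    have hnn : ∀ b : X × Y, 0 ≤ -(p b * Real.logb 2 (p b / marginal p b.2)) := fun b => by
      have h2 : Real.logb 2 (p b / marginal p b.2) ≤ 0 :=
        Real.logb_nonpos one_lt_two (div_nonneg (hp.1.1 b) (marginal_nonneg hp.1.1 _))
          (div_le_one_of_le₀ (le_marginal hp.1.1 b) (marginal_nonneg hp.1.1 _))
      exact neg_nonneg.2 (mul_nonpos_of_nonneg_of_nonpos (hp.1.1 b) h2)
    have hs : ∑ b : X × Y, -(p b * Real.logb 2 (p b / marginal p b.2)) = 0 := by
      rw [Finset.sum_neg_distrib]; exact h0.symm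
    have := (Finset.sum_eq_zero_iff_of_nonneg fun b _ => hnn b).1 hs a (Finset.mem_univ _)
    have hl : Real.logb 2 (p a / marginal p a.2) = 0 :=
      (mul_eq_zero.1 (neg_eq_zero.1 this)).resolve_left ha
    have hpos : 0 < p a / marginal p a.2 :=
      div_pos ((hp.1.1 a).lt_of_ne ha.symm) (hp.marginal_pos _)
    have h1 := Real.eq_one_of_pos_of_logb_eq_zero one_lt_two hpos hl
    rwa [div_eq_one_iff_eq (hp.marginal_pos _).ne'] at h1
  have huniq : ∀ y, supportCard p y ≤ 1 := by
    intro y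
    rw [supportCard, Finset.card_le_one]
    intro x hx x' hx'
    by_contra hne
    have hx := (Finset.mem_filter.1 hx).2
    have hx' := (Finset.mem_filter.1 hx').2
    have hle : p (x, y) + p (x', y) ≤ marginal p y := by
      classical
      rw [← Finset.sum_pair hne (f := fun x => p (x, y))]
      exact Finset.sum_le_univ_sum_of_nonneg fun x => hp.1.1 (x, y)
    have := hterm (x, y) hx.ne'
    dsimp only at this
    linarith
  obtain ⟨y, hy⟩ := exists_supportCard p
  have hM : maxSupport p = 1 :=
    le_antisymm (hy ▸ huniq y) (hy ▸ hp.supportCard_pos y)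
  have h1 := condEntropy_lt_gallager_div hp h one_pos
  have h2 := gallager_le_mul_logb_maxSupport hp one_pos
  rw [hM] at h2
  simp at h2
  rw [← h0, div_one] at h1
  linarith

/-! ### The focusing bound and its parametric form -/

lemma focusingBound_le {R α : ℝ} (hα : 0 < α) {q : X × Y → ℝ}
    (hq : q ∈ stdSimplex ℝ (X × Y)) (h : ∀ a, p a = 0 → q a = 0)
    (hH : (α + 1) * R ≤ condEntropy q) :
    focusingBound p R ≤ ((1 / α * divergence q p : ℝ) : EReal) := by
  refine (iInf₂_le α hα).trans ?_
  rw [EReal.coe_mul]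
  refine mul_le_mul_of_nonneg_left ?_ (by exact_mod_cast (one_div_pos.2 hα).le)
  rw [← relEntropy_of_ac h]
  exact iInf₂_le_of_le q hq (iInf_le _ hH)

lemma le_focusingBound {R : ℝ} {s : EReal}
    (h : ∀ α : ℝ, 0 < α → ∀ q ∈ stdSimplex ℝ (X × Y), (α + 1) * R ≤ condEntropy q →
      (∀ a, p a = 0 → q a = 0) → s ≤ ((1 / α * divergence q p : ℝ) : EReal)) :
    s ≤ focusingBound p R := by
  refine le_iInf₂ fun α hα => ?_
  have hαi : (0 : EReal) < ((1 / α : ℝ) : EReal) := by exact_mod_cast one_div_pos.2 hα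
  have hmul : ((1 / α : ℝ) : EReal) * ((α : EReal) * s) = s := by
    rw [← mul_assoc, ← EReal.coe_mul, one_div_mul_cancel hα.ne', EReal.coe_one, one_mul]
  rw [← hmul]
  refine mul_le_mul_of_nonneg_left ?_ hαi.le
  refine le_iInf₂ fun q hq => le_iInf fun hH => ?_
  by_cases hac : ∀ a, p a = 0 → q a = 0
  · rw [relEntropy_of_ac hac]
    have := mul_le_mul_of_nonneg_left (h α hα q hq hH hac)
      (show (0 : EReal) ≤ (α : EReal) by exact_mod_cast hα.le)
    rwa [← EReal.coe_mul, ← mul_assoc, mul_one_div_cancel hα.ne', one_mul] at this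
  · rw [relEntropy, if_neg hac]; exact le_top

lemma focusingBound_nonneg (hp : IsSource p) (R : ℝ) : 0 ≤ focusingBound p R :=
  le_focusingBound fun α hα q hq _ hac => by
    exact_mod_cast mul_nonneg (one_div_pos.2 hα).le (divergence_nonneg hq hp.1 hac)

lemma focusingBound_mono : Monotone (focusingBound p) := fun R R' h =>
  le_focusingBound fun α hα q hq hH hac => focusingBound_le hα hq hac
    ((mul_le_mul_of_nonneg_left h (by linarith)).trans hH)

/-- Weak duality: every `ρ` with `E₀(ρ) ≤ ρR` gives the lower bound `ρR` on the exponent. -/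
lemma mul_le_focusingBound (hp : IsSource p) {ρ R : ℝ} (hρ : 0 < ρ) (h : gallager p ρ ≤ ρ * R) :
    ((ρ * R : ℝ) : EReal) ≤ focusingBound p R :=
  le_focusingBound fun α hα q hq hH hac => by
    have v := mul_condEntropy_sub_divergence_le hp (ρ := ρ) (by linarith) hq hac
    have := mul_le_mul_of_nonneg_left hH hρ.le
    refine EReal.coe_le_coe_iff.2 ?_
    rw [one_div_mul_eq_div, le_div_iff₀ hα]
    nlinarith

lemma focusingBound_gallager_div (hp : IsSource p) {ρ : ℝ} (hρ : 0 < ρ)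
    (h : condEntropy p < gallager p ρ / ρ) :
    focusingBound p (gallager p ρ / ρ) = (gallager p ρ : EReal) := by
  have hm : -1 < ρ := by linarith
  set R := gallager p ρ / ρ with hR
  have hRρ : gallager p ρ = ρ * R := by rw [hR]; field_simp
  have hR0 : 0 < R := (condEntropy_nonneg hp.1.1).trans_lt h
  refine le_antisymm ?_ ?_
  · -- the tilted law is the dominant error event
    have hlt : R < condEntropy (tilted p ρ) := by
      have := gallager_lt_mul_condEntropy_tilted hp hm (by
        rw [hRρ]; exact mul_lt_mul_of_pos_left h hρ)
      rw [hRρ] at this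
      exact lt_of_mul_lt_mul_left this hρ.le
    have hα : 0 < condEntropy (tilted p ρ) / R - 1 := by
      rw [sub_pos, one_lt_div hR0]; exact hlt
    refine (focusingBound_le hα (tilted_mem hp hm) (fun a => tilted_eq_zero hp hm) ?_).trans ?_
    · rw [sub_add_cancel, div_mul_cancel₀ _ hR0.ne']
    · refine EReal.coe_le_coe_iff.2 ?_
      have e := gallager_eq_tilted hp hm
      have hD : divergence (tilted p ρ) p = ρ * R * (condEntropy (tilted p ρ) / R - 1) := by
        field_simp
        linarith
      rw [hD, hRρ, one_div_mul_eq_div, mul_div_cancel_right₀ _ hα.ne']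
  · rw [hRρ]
    exact mul_le_focusingBound hp hρ hRρ.le

lemma exists_gallager_div_eq (hp : IsSource p) {R : ℝ} (hR : condEntropy p < R)
    (hM : R < Real.logb 2 (maxSupport p)) : ∃ ρ : ℝ, 0 < ρ ∧ R = gallager p ρ / ρ := by
  obtain ⟨ρ₀, h1, h2 : 0 < ρ₀⟩ := (((tendsto_gallager_div hp).eventually
    (gt_mem_nhds hR)).and self_mem_nhdsWithin).exists
  obtain ⟨q, hq, hqp, hH⟩ := exists_condEntropy_eq_logb_maxSupport hp
  set ρ₁ := ρ₀ + divergence q p / (Real.logb 2 (maxSupport p) - R) with hρ₁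
  have hgap : 0 < Real.logb 2 (maxSupport p) - R := sub_pos.2 hM
  have hle : ρ₀ ≤ ρ₁ := by
    have := div_nonneg (divergence_nonneg hq hp.1 hqp) hgap.le
    linarith
  have h3 : R ≤ gallager p ρ₁ / ρ₁ := by
    have hpos : 0 < ρ₁ := h2.trans_le hle
    rw [le_div_iff₀ hpos]
    have v := mul_condEntropy_sub_divergence_le hp (ρ := ρ₁) (by linarith) hq hqp
    rw [hH] at v
    have e : divergence q p = (ρ₁ - ρ₀) * (Real.logb 2 (maxSupport p) - R) := by
      rw [hρ₁]; field_simp; ring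
    have : 0 < ρ₀ * (Real.logb 2 (maxSupport p) - R) := mul_pos h2 hgap
    nlinarith
  have hc : ContinuousOn (fun ρ => gallager p ρ / ρ) (Set.Icc ρ₀ ρ₁) := fun ρ hρ =>
    have hρ0 : 0 < ρ := h2.trans_le hρ.1
    ((contDiffAt_gallager hp (by linarith)).continuousAt.div continuousAt_id
      hρ0.ne').continuousWithinAt
  obtain ⟨ρ, hρ, he⟩ := intermediate_value_Icc hle hc ⟨h1.le, h3⟩
  exact ⟨ρ, h2.trans_le hρ.1, he.symm⟩

lemma existsUnique_gallager_div_eq (hp : IsSource p) {R : ℝ} (hR : condEntropy p < R)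
    (hM : R < Real.logb 2 (maxSupport p)) : ∃! ρ : ℝ, 0 < ρ ∧ R = gallager p ρ / ρ := by
  obtain ⟨ρ, h0, hρ⟩ := exists_gallager_div_eq hp hR hM
  refine ⟨ρ, ⟨h0, hρ⟩, fun σ ⟨h1, hσ⟩ => ?_⟩
  rcases lt_trichotomy σ ρ with h | h | h
  · have := gallager_div_lt_gallager_div hp h1 h (hσ ▸ hR)
    rw [← hρ, ← hσ] at this
    exact absurd this (lt_irrefl _)
  · exact h
  · have := gallager_div_lt_gallager_div hp h0 h (hρ ▸ hR)
    rw [← hρ, ← hσ] at this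
    exact absurd this (lt_irrefl _)

lemma focusingBound_eq_top (hp : IsSource p) {R : ℝ} (hR : condEntropy p < R)
    (hM : Real.logb 2 (maxSupport p) ≤ R) : focusingBound p R = ⊤ := by
  have hR0 : 0 < R := (condEntropy_nonneg hp.1.1).trans_lt hR
  rw [EReal.eq_top_iff_forall_lt]
  intro s
  have hρ : 0 < (|s| + 1) / R := by positivity
  have h := mul_le_focusingBound hp hρ
    (gallager_lt_mul_of_logb_maxSupport_le hp hR hM hρ).le
  rw [div_mul_cancel₀ _ hR0.ne'] at h
  refine lt_of_lt_of_le ?_ h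
  exact EReal.coe_lt_coe_iff.2 (by linarith [le_abs_self s])

/-- Strong duality: exponents below the focusing bound are certified by a Chernoff parameter `ρ`
with a strict inequality `E₀(ρ) < ρR`. -/
lemma exists_gallager_lt_mul (hp : IsSource p) {R s : ℝ} (hR : condEntropy p < R)
    (hs : (s : EReal) < focusingBound p R) : ∃ ρ, 0 < ρ ∧ gallager p ρ < ρ * R ∧ s < ρ * R := by
  have hR0 : 0 < R := (condEntropy_nonneg hp.1.1).trans_lt hR
  rcases lt_or_ge R (Real.logb 2 (maxSupport p)) with hM | hM
  · obtain ⟨τ, h0, hτ⟩ := exists_gallager_div_eq hp hR hM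
    rw [hτ, focusingBound_gallager_div hp h0 (hτ ▸ hR), EReal.coe_lt_coe_iff] at hs
    have hτ' : gallager p τ = τ * R := by rw [hτ]; field_simp
    have hlt : max (s / R) 0 < τ := by
      refine max_lt ?_ h0
      rw [div_lt_iff₀ hR0]; linarith
    obtain ⟨ρ, h1, h2⟩ := exists_between hlt
    have hρ : 0 < ρ := (le_max_right _ _).trans_lt h1
    refine ⟨ρ, hρ, ?_, (div_lt_iff₀ hR0).1 ((le_max_left _ _).trans_lt h1)⟩
    by_contra hcon
    have h3 : R ≤ gallager p ρ / ρ := by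
      rw [le_div_iff₀ hρ]; linarith
    have := gallager_div_lt_gallager_div hp hρ h2 (hR.trans_le h3)
    rw [← hτ] at this
    linarith
  · have hρ : 0 < (|s| + 1) / R := by positivity
    refine ⟨(|s| + 1) / R, hρ, gallager_lt_mul_of_logb_maxSupport_le hp hR hM hρ, ?_⟩
    rw [div_mul_cancel₀ _ hR0.ne']
    linarith [le_abs_self s]

lemma focusingBound_eq_zero_of_lt (hp : IsSource p) {R : ℝ} (h0 : 0 ≤ R)
    (hR : R < condEntropy p) : focusingBound p R = 0 := by
  refine le_antisymm ?_ (focusingBound_nonneg hp R)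
  have key : ∀ α : ℝ, 0 < α → (α + 1) * R ≤ condEntropy p → focusingBound p R ≤ 0 :=
    fun α hα hH => by
      simpa [divergence_self] using focusingBound_le hα hp.1 (fun a h => h) hH
  rcases h0.eq_or_lt with rfl | hR0
  · exact key 1 one_pos (by simpa using condEntropy_nonneg hp.1.1)
  · refine key (condEntropy p / R - 1) ?_ ?_
    · rw [sub_pos, one_lt_div hR0]; exact hR
    · rw [sub_add_cancel, div_mul_cancel₀ _ hR0.ne']

/-! ### The exponent near the conditional entropy -/

section Slope

variable (hp : IsSource p) (h2 : 0 < gallagerSecond p)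
include hp h2

lemma condEntropy_lt_logb_maxSupport : condEntropy p < Real.logb 2 (maxSupport p) := by
  have h := condEntropy_lt_gallager_div hp h2 one_pos
  have h' := gallager_le_mul_logb_maxSupport hp one_pos
  rw [div_one] at h
  linarith

lemma eventually_lt_logb_maxSupport :
    ∀ᶠ R in 𝓝[>] (condEntropy p), R < Real.logb 2 (maxSupport p) :=
  nhdsWithin_le_nhds (gt_mem_nhds (condEntropy_lt_logb_maxSupport hp h2))

lemma focusingBound_condEntropy : focusingBound p (condEntropy p) = 0 := by
  refine le_antisymm ?_ (focusingBound_nonneg hp _)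
  have hlim : Tendsto (fun ρ => ((gallager p ρ : ℝ) : EReal)) (𝓝[>] 0) (𝓝 ((0 : ℝ) : EReal)) := by
    refine (continuous_coe_real_ereal.tendsto 0).comp ?_
    have := (contDiffAt_gallager hp (ρ := 0) (by norm_num)).continuousAt.tendsto
    rw [gallager_zero hp] at this
    exact this.mono_left nhdsWithin_le_nhds
  refine ge_of_tendsto hlim ?_
  filter_upwards [self_mem_nhdsWithin] with ρ (hρ : 0 < ρ)
  have h := condEntropy_lt_gallager_div hp h2 hρ
  rw [← focusingBound_gallager_div hp hρ h]
  exact focusingBound_mono h.le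

lemma eventually_focusingBound_ne_top :
    ∀ᶠ R in 𝓝[>] (condEntropy p), focusingBound p R ≠ ⊤ := by
  filter_upwards [eventually_lt_logb_maxSupport hp h2, self_mem_nhdsWithin]
    with R hM (hR : condEntropy p < R)
  obtain ⟨ρ, h0, hρ⟩ := exists_gallager_div_eq hp hR hM
  rw [hρ, focusingBound_gallager_div hp h0 (hρ ▸ hR)]
  exact EReal.coe_ne_top _

lemma hasDerivWithinAt_focusingBound :
    HasDerivWithinAt (fun R => (focusingBound p R).toReal)
      (2 * condEntropy p / gallagerSecond p) (Set.Ici (condEntropy p)) (condEntropy p) := by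
  rw [← hasDerivWithinAt_Ioi_iff_Ici, hasDerivWithinAt_iff_tendsto_slope' Set.self_notMem_Ioi]
  -- the slope along the parametrisation `R = E₀(ρ)/ρ`, whose limit comes from the expansion of `E₀`
  have hψ : Tendsto (fun ρ => gallager p ρ / (gallager p ρ / ρ - condEntropy p)) (𝓝[>] 0)
      (𝓝 (2 * condEntropy p / gallagerSecond p)) := by
    have h := (tendsto_gallager_div hp).div (tendsto_gallager_second hp) (by linarith)
    have e : condEntropy p / (gallagerSecond p / 2) = 2 * condEntropy p / gallagerSecond p := by
      field_simp
    rw [e] at h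
    refine h.congr' ?_
    filter_upwards [self_mem_nhdsWithin] with ρ (hρ : 0 < ρ)
    have h3 := condEntropy_lt_gallager_div hp h2 hρ
    have h4 : gallager p ρ / ρ - condEntropy p ≠ 0 := by linarith
    have h5 : gallager p ρ - ρ * condEntropy p ≠ 0 := by
      rw [lt_div_iff₀ hρ] at h3; linarith
    rw [Pi.div_apply, div_div_eq_mul_div, div_mul_eq_mul_div, div_div,
      div_eq_div_iff (by positivity) h4]
    field_simp
  choose! f hf0 hf using fun R (hR : condEntropy p < R ∧ R < Real.logb 2 (maxSupport p)) =>
    exists_gallager_div_eq hp hR.1 hR.2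
  have hev : ∀ᶠ R in 𝓝[>] (condEntropy p),
      condEntropy p < R ∧ R < Real.logb 2 (maxSupport p) := by
    filter_upwards [eventually_lt_logb_maxSupport hp h2, self_mem_nhdsWithin] with R hM hR
    exact ⟨hR, hM⟩
  have hflim : Tendsto f (𝓝[>] (condEntropy p)) (𝓝[>] 0) := by
    rw [tendsto_nhdsWithin_iff]
    refine ⟨?_, hev.mono fun R hR => hf0 R hR⟩
    rw [tendsto_order]
    refine ⟨fun a ha => hev.mono fun R hR => ha.trans (hf0 R hR), fun ε hε => ?_⟩
    have hsm : ∀ᶠ R in 𝓝[>] (condEntropy p), R < gallager p ε / ε :=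
      nhdsWithin_le_nhds (gt_mem_nhds (condEntropy_lt_gallager_div hp h2 hε))
    filter_upwards [hev, hsm] with R hR hRε
    by_contra hcon
    rcases (not_lt.1 hcon).eq_or_lt with h | h
    · rw [h] at hRε
      exact hRε.ne (hf R hR)
    · have := gallager_div_lt_gallager_div hp hε h (condEntropy_lt_gallager_div hp h2 hε)
      rw [← hf R hR] at this
      linarith
  refine (hψ.comp hflim).congr' ?_
  filter_upwards [hev] with R hR
  rw [slope_def_field, focusingBound_condEntropy hp h2, EReal.toReal_zero, sub_zero]
  have e := focusingBound_gallager_div hp (hf0 R hR) (hf R hR ▸ hR.1)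
  rw [← hf R hR] at e
  rw [e, EReal.toReal_coe, Function.comp_apply, ← hf R hR]

end Slope

end

section

/-! ### Expectations over iid streams -/

section Stream

variable {Z : Type*}

/-- The stream `a, z 0, z 1, …`. -/
def streamCons (a : Z) (z : ℕ → Z) : ℕ → Z
  | 0 => a
  | k + 1 => z k

variable [Fintype Z] [Nonempty Z]

/-- The expectation of `f` over streams whose first `n` symbols are iid with law `p`; the later
symbols are set to an arbitrary constant. -/
def streamExpect (p : Z → ℝ) : ℕ → ((ℕ → Z) → ℝ) → ℝ
  | 0, f => f fun _ => Classical.arbitrary Z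
  | n + 1, f => ∑ a, p a * streamExpect p n fun z => f (streamCons a z)

variable {p : Z → ℝ}

lemma streamExpect_mono (hp : p ∈ stdSimplex ℝ Z) (n : ℕ) {f g : (ℕ → Z) → ℝ}
    (h : ∀ z, f z ≤ g z) : streamExpect p n f ≤ streamExpect p n g := by
  induction n generalizing f g with
  | zero => exact h _
  | succ n ih =>
    exact Finset.sum_le_sum fun a _ => mul_le_mul_of_nonneg_left (ih fun z => h _) (hp.1 a)

lemma streamExpect_const (hp : p ∈ stdSimplex ℝ Z) (n : ℕ) (c : ℝ) :
    streamExpect p n (fun _ => c) = c := by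
  induction n with
  | zero => rfl
  | succ n ih => simp only [streamExpect, ih]; rw [← Finset.sum_mul, hp.2, one_mul]

lemma streamExpect_add (n : ℕ) (f g : (ℕ → Z) → ℝ) :
    streamExpect p n (fun z => f z + g z) = streamExpect p n f + streamExpect p n g := by
  induction n generalizing f g with
  | zero => rfl
  | succ n ih => simp only [streamExpect, ih, mul_add, Finset.sum_add_distrib]

lemma streamExpect_mul_left (n : ℕ) (c : ℝ) (f : (ℕ → Z) → ℝ) :
    streamExpect p n (fun z => c * f z) = c * streamExpect p n f := by
  induction n generalizing f with
  | zero => rfl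
  | succ n ih =>
    simp only [streamExpect, ih, Finset.mul_sum]
    exact Finset.sum_congr rfl fun a _ => by ring

lemma streamExpect_sum {ι : Type*} (s : Finset ι) (n : ℕ) (f : ι → (ℕ → Z) → ℝ) :
    streamExpect p n (fun z => ∑ i ∈ s, f i z) = ∑ i ∈ s, streamExpect p n (f i) := by
  induction n generalizing f with
  | zero => rfl
  | succ n ih =>
    simp only [streamExpect, ih, Finset.mul_sum]
    exact Finset.sum_comm

lemma streamExpect_nonneg (hp : p ∈ stdSimplex ℝ Z) (n : ℕ) {f : (ℕ → Z) → ℝ}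
    (h : ∀ z, 0 ≤ f z) : 0 ≤ streamExpect p n f :=
  (streamExpect_const hp n 0).symm.le.trans (streamExpect_mono hp n h)

/-- Independence of the first `a` symbols from the later ones. -/
lemma streamExpect_mul_shift (a b : ℕ) {f : (ℕ → Z) → ℝ}
    (hf : DependsOn f (Set.Iio a)) (g : (ℕ → Z) → ℝ) :
    streamExpect p (a + b) (fun z => f z * g fun k => z (a + k)) =
      streamExpect p a f * streamExpect p b g := by
  induction a generalizing f with
  | zero =>
    have hc : ∀ z, f z = f fun _ => Classical.arbitrary Z := fun z => hf fun i hi => by simp at hi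
    simp only [Nat.zero_add]
    rw [show (fun z => f z * g fun k => z k) =
      fun z => (f fun _ => Classical.arbitrary Z) * g z from funext fun z => by rw [← hc z]]
    exact streamExpect_mul_left _ _ _
  | succ a ih =>
    rw [Nat.add_right_comm]
    simp only [streamExpect, Finset.sum_mul]
    refine Finset.sum_congr rfl fun s _ => ?_
    rw [mul_assoc, ← ih]
    · congr 2
      funext z
      congr 2
      funext k
      rw [Nat.add_right_comm]; rfl
    · intro z z' h
      refine hf fun i hi => ?_
      cases i with
      | zero => rfl
      | succ i => exact h i (Nat.lt_of_succ_lt_succ hi)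

lemma streamExpect_of_dependsOn (hp : p ∈ stdSimplex ℝ Z) {a n : ℕ} (h : a ≤ n)
    {f : (ℕ → Z) → ℝ} (hf : DependsOn f (Set.Iio a)) :
    streamExpect p n f = streamExpect p a f := by
  obtain ⟨b, rfl⟩ := Nat.exists_eq_add_of_le h
  simpa [streamExpect_const hp] using streamExpect_mul_shift a b hf (p := p) fun _ => 1

/-- The extension of a finite word to a stream by a constant. -/
def streamExtend {n : ℕ} (z : Fin n → Z) (k : ℕ) : Z :=
  if h : k < n then z ⟨k, h⟩ else Classical.arbitrary Z

lemma streamExtend_apply {n : ℕ} (z : Fin n → Z) (k : Fin n) : streamExtend z k = z k := by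
  simp [streamExtend]

lemma streamExtend_cons {n : ℕ} (a : Z) (z : Fin n → Z) :
    streamExtend (Fin.cons a z : Fin (n + 1) → Z) = streamCons a (streamExtend z) := by
  funext k
  cases k with
  | zero => simp [streamExtend, streamCons]
  | succ k =>
    simp only [streamExtend, streamCons, Nat.succ_lt_succ_iff]
    split_ifs with h
    · exact Fin.cons_succ (α := fun _ => Z) a z ⟨k, h⟩
    · rfl

lemma streamExpect_eq_sum (n : ℕ) (f : (ℕ → Z) → ℝ) :
    streamExpect p n f = ∑ z : Fin n → Z, (∏ k, p (z k)) * f (streamExtend z) := by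
  induction n generalizing f with
  | zero =>
    rw [Fintype.sum_unique]
    simp only [streamExpect, Finset.univ_eq_empty, Finset.prod_empty, one_mul]
    congr 1
  | succ n ih =>
    rw [← (Fin.consEquiv fun _ => Z).sum_comp, Fintype.sum_prod_type]
    simp only [streamExpect, ih, Finset.mul_sum]
    refine Finset.sum_congr rfl fun a _ => Finset.sum_congr rfl fun z _ => ?_
    change _ = (∏ k, p ((Fin.cons a z : Fin (n + 1) → Z) k)) * f (streamExtend (Fin.cons a z))
    rw [streamExtend_cons, Fin.prod_univ_succ]
    simp only [Fin.cons_zero, Fin.cons_succ]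
    ring

end Stream

/-! ### Codes on streams -/

section Codes

variable {X Y : Type*}

/-- The bits emitted until time `n` when the source emits the stream `z`. -/
def streamBits {R : ℝ} (e : Encoder X Y R) (n : ℕ) (z : ℕ → X × Y) : List Bool :=
  bitsUpTo e n (fun k => (z k).1) fun k => (z k).2

/-- The bits sent between time `n` and time `n + 1`. -/
def streamChunk {R : ℝ} (e : Encoder X Y R) (n : ℕ) (z : ℕ → X × Y) : List Bool :=
  List.ofFn (e (n + 1) (fun k => (z k).1) fun k => (z k).2)

lemma length_streamChunk {R : ℝ} (e : Encoder X Y R) (n : ℕ) (z : ℕ → X × Y) :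
    (streamChunk e n z).length = numBits R (n + 1) := List.length_ofFn

lemma streamBits_zero {R : ℝ} (e : Encoder X Y R) (z : ℕ → X × Y) : streamBits e 0 z = [] := rfl

lemma streamBits_succ {R : ℝ} (e : Encoder X Y R) (n : ℕ) (z : ℕ → X × Y) :
    streamBits e (n + 1) z = streamBits e n z ++ streamChunk e n z := by
  simp only [streamBits, bitsUpTo]
  rw [List.finRange_succ_last, List.flatMap_append, List.flatMap_map]
  simp only [List.flatMap_cons, List.flatMap_nil, List.append_nil]
  rfl

/-- The number `⌊nR⌋` of bits sent until time `n`. -/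
def bitBudget (R : ℝ) (n : ℕ) : ℕ := ⌊(n : ℝ) * R⌋₊

lemma numBits_succ (R : ℝ) (j : ℕ) : numBits R (j + 1) = bitBudget R (j + 1) - bitBudget R j := by
  simp [numBits, bitBudget]

lemma bitBudget_mono {R : ℝ} (hR : 0 ≤ R) : Monotone (bitBudget R) := fun _ _ h =>
  Nat.floor_mono (mul_le_mul_of_nonneg_right (by exact_mod_cast h) hR)

lemma length_streamBits {R : ℝ} (hR : 0 ≤ R) (e : Encoder X Y R) (n : ℕ) (z : ℕ → X × Y) :
    (streamBits e n z).length = bitBudget R n := by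
  induction n with
  | zero => simp [streamBits_zero, bitBudget]
  | succ n ih =>
    rw [streamBits_succ, List.length_append, ih, length_streamChunk, numBits_succ,
      Nat.add_sub_cancel' (bitBudget_mono hR n.le_succ)]

lemma streamBits_prefix {R : ℝ} (e : Encoder X Y R) {a b : ℕ} (h : a ≤ b) (z : ℕ → X × Y) :
    streamBits e a z <+: streamBits e b z := by
  induction b, h using Nat.le_induction with
  | base => exact List.prefix_rfl
  | succ b _ ih => rw [streamBits_succ]; exact ih.trans (List.prefix_append _ _)

lemma streamBits_eq_of_le {R : ℝ} (hR : 0 ≤ R) (e : Encoder X Y R) {a b : ℕ} (h : a ≤ b)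
    {z z' : ℕ → X × Y} (hz : streamBits e b z = streamBits e b z') :
    streamBits e a z = streamBits e a z' := by
  have h1 := streamBits_prefix e h z
  have h2 := streamBits_prefix e h z'
  rw [← hz] at h2
  rw [List.prefix_iff_eq_take.1 h1, List.prefix_iff_eq_take.1 h2, length_streamBits hR,
    length_streamBits hR]

lemma streamBits_dependsOn {R : ℝ} (e : Encoder X Y R) (n : ℕ) :
    DependsOn (streamBits e n) (Set.Iio n) := fun z z' h => by
  have : ∀ k : Fin n, z k = z' k := fun k => h k k.2
  simp only [streamBits, this]

variable [Fintype X] [Fintype Y] [Nonempty X] [Nonempty Y]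

/-- The event that the symbol number `i` is decoded wrongly. -/
def DecodedWrong {R : ℝ} {Δ : ℕ} (e : Encoder X Y R) (d : Decoder X Y Δ) (i : ℕ)
    (z : ℕ → X × Y) : Prop :=
  d i (streamBits e (i + 1 + Δ) z) (fun k => (z k).2) ≠ (z i).1

open Classical in
/-- The indicator of the event that the symbol number `i` is decoded wrongly. -/
def errorIndicator {R : ℝ} {Δ : ℕ} (e : Encoder X Y R) (d : Decoder X Y Δ) (i : ℕ)
    (z : ℕ → X × Y) : ℝ :=
  if DecodedWrong e d i z then 1 else 0

lemma errorIndicator_dependsOn {R : ℝ} {Δ : ℕ} (e : Encoder X Y R) (d : Decoder X Y Δ) (i : ℕ) :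
    DependsOn (errorIndicator e d i) (Set.Iio (i + 1 + Δ)) := fun z z' h => by
  have h1 : ∀ k : Fin (i + 1 + Δ), z k = z' k := fun k => h k k.2
  have h2 := streamBits_dependsOn e (i + 1 + Δ) h
  have h3 : z i = z' i := h i (by simp; omega)
  have : DecodedWrong e d i z = DecodedWrong e d i z' := by
    simp only [DecodedWrong, h1, h2, h3]
  unfold errorIndicator
  classical exact if_congr (iff_of_eq this) rfl rfl

lemma errorProb_eq_streamExpect (p : X × Y → ℝ) {R : ℝ} {Δ : ℕ} (e : Encoder X Y R)
    (d : Decoder X Y Δ) (i : ℕ) :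
    errorProb p e d i = streamExpect p (i + 1 + Δ) (errorIndicator e d i) := by
  classical
  rw [streamExpect_eq_sum]
  refine Finset.sum_congr rfl fun z _ => ?_
  have h : streamExtend z i = z ⟨i, by omega⟩ := streamExtend_apply z ⟨i, by omega⟩
  rw [errorIndicator, mul_ite, mul_one, mul_zero]
  refine if_congr ?_ rfl rfl
  simp only [DecodedWrong, streamBits, streamExtend_apply, h]

lemma errorProb_le_one {p : X × Y → ℝ} (hp : p ∈ stdSimplex ℝ (X × Y)) {R : ℝ} {Δ : ℕ}
    (e : Encoder X Y R) (d : Decoder X Y Δ) (i : ℕ) : errorProb p e d i ≤ 1 := by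
  rw [errorProb_eq_streamExpect, ← streamExpect_const hp (i + 1 + Δ) 1]
  exact streamExpect_mono hp _ fun z => by unfold errorIndicator; split_ifs <;> norm_num

end Codes

end

section

variable {X Y : Type*} {N : ℕ} {c : (Fin N → X) → (Fin N → Y) → List Bool} {R : ℝ}

/-! ### The FIFO queue on streams -/

/-- The queue just after time `j` when the source emits the stream `z`. -/
def streamQueue (c : (Fin N → X) → (Fin N → Y) → List Bool) (R : ℝ) (j : ℕ) (z : ℕ → X × Y) :
    List Bool :=
  queue c R j (fun k => (z k).1) fun k => (z k).2

/-- The bits that enter the queue at time `j`. -/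
def streamArrivals (c : (Fin N → X) → (Fin N → Y) → List Bool) (j : ℕ) (z : ℕ → X × Y) :
    List Bool :=
  arrivals c j (fun k => (z k).1) fun k => (z k).2

/-- The codeword of the block number `b`, counted from `0`. -/
def blockWord (c : (Fin N → X) → (Fin N → Y) → List Bool) (b : ℕ) (z : ℕ → X × Y) : List Bool :=
  c (fun k => (z (b * N + k)).1) fun k => (z (b * N + k)).2

/-- The content of the queue at the time `(b + 1) N` at which the codeword of block `b` enters,
before any bit is sent at that time. -/
def blockContent (c : (Fin N → X) → (Fin N → Y) → List Bool) (R : ℝ) (b : ℕ) (z : ℕ → X × Y) :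
    List Bool :=
  streamQueue c R (b * N + (N - 1)) z ++ blockWord c b z

/-- The codeword of block `b` has left the queue by time `n`. -/
def Drained (c : (Fin N → X) → (Fin N → Y) → List Bool) (R : ℝ) (b n : ℕ) (z : ℕ → X × Y) :
    Prop :=
  bitBudget R (b * N + (N - 1)) + (blockContent c R b z).length ≤ bitBudget R n

lemma streamQueue_zero (z : ℕ → X × Y) : streamQueue c R 0 z = [] := rfl

lemma streamQueue_succ (j : ℕ) (z : ℕ → X × Y) : streamQueue c R (j + 1) z =
    (streamQueue c R j z ++ streamArrivals c (j + 1) z).drop (numBits R (j + 1)) := rfl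

lemma streamQueue_dependsOn (j : ℕ) :
    DependsOn (streamQueue c R j) (Set.Iio j) := fun z z' h => by
  have : ∀ k : Fin j, z k = z' k := fun k => h k k.2
  simp only [streamQueue, this]

lemma streamArrivals_of_not_dvd {j : ℕ} (h : ¬ N ∣ j) (z : ℕ → X × Y) :
    streamArrivals c j z = [] :=
  dif_neg fun h' => h h'.2

lemma streamArrivals_block (hN : 0 < N) (b : ℕ) (z : ℕ → X × Y) :
    streamArrivals c (b * N + (N - 1) + 1) z = blockWord c b z := by
  have e : b * N + (N - 1) + 1 = (b + 1) * N := by rw [add_mul, one_mul]; omega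
  have e2 : ∀ k, b * N + (N - 1) + 1 - N + k = b * N + k := fun k => by omega
  have h : 0 < b * N + (N - 1) + 1 ∧ N ∣ b * N + (N - 1) + 1 :=
    ⟨Nat.succ_pos _, e ▸ Dvd.intro_left _ rfl⟩
  simp only [streamArrivals, arrivals, dif_pos h, blockWord, e2]

/-- Between two block ends the queue is only drained. -/
lemma streamQueue_add (hR : 0 ≤ R) (b : ℕ) {r : ℕ} (hr : r < N) (z : ℕ → X × Y) :
    streamQueue c R (b * N + r) z =
      (streamQueue c R (b * N) z).drop (bitBudget R (b * N + r) - bitBudget R (b * N)) := by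
  induction r with
  | zero => simp
  | succ r ih =>
    have hnd : ¬ N ∣ b * N + r + 1 := fun hd => by
      have : N ∣ r + 1 := (Nat.dvd_add_right (Dvd.intro_left b rfl)).1 (by rwa [← add_assoc])
      exact absurd (Nat.le_of_dvd (Nat.succ_pos _) this) (by omega)
    rw [← add_assoc, streamQueue_succ, streamArrivals_of_not_dvd hnd, List.append_nil,
      ih (by omega), List.drop_drop, numBits_succ]
    have h1 := bitBudget_mono hR (show b * N ≤ b * N + r by omega)
    have h2 := bitBudget_mono hR (show b * N + r ≤ b * N + r + 1 by omega)
    congr 1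
    omega

lemma streamQueue_add_dependsOn (hR : 0 ≤ R) (b : ℕ) {r : ℕ} (hr : r < N) :
    DependsOn (streamQueue c R (b * N + r)) (Set.Iio (b * N)) := fun z z' h => by
  rw [streamQueue_add hR b hr, streamQueue_add hR b hr, streamQueue_dependsOn _ h]

lemma streamQueue_block_zero (hN : 0 < N) (hR : 0 ≤ R) (z : ℕ → X × Y) :
    streamQueue c R (0 * N + (N - 1)) z = [] := by
  rw [streamQueue_add hR 0 (by omega), Nat.zero_mul, streamQueue_zero, List.drop_nil]

/-- Lindley's recursion: the backlog found by a block is what its predecessor left, less the bits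
sent meanwhile. -/
lemma length_streamQueue_block_succ (hN : 0 < N) (hR : 0 ≤ R) (b : ℕ) (z : ℕ → X × Y) :
    (streamQueue c R ((b + 1) * N + (N - 1)) z).length = (blockContent c R b z).length -
      (bitBudget R ((b + 1) * N + (N - 1)) - bitBudget R (b * N + (N - 1))) := by
  have e : (b + 1) * N = b * N + (N - 1) + 1 := by rw [add_mul, one_mul]; omega
  rw [streamQueue_add hR (b + 1) (by omega), List.length_drop, e, streamQueue_succ,
    streamArrivals_block hN, List.length_drop, numBits_succ, blockContent]
  have h1 := bitBudget_mono hR (show b * N + (N - 1) ≤ b * N + (N - 1) + 1 by omega)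
  have h2 := bitBudget_mono hR
    (show b * N + (N - 1) + 1 ≤ b * N + (N - 1) + 1 + (N - 1) by omega)
  omega

/-- No bit is lost: the bits sent until time `n` followed by the queue and by the new codeword are
a prefix of what has been sent until time `n + 1` followed by the new queue. -/
lemma streamBits_append_prefix_succ (n : ℕ) (z : ℕ → X × Y) :
    streamBits (fifoEncoder c R) n z ++ (streamQueue c R n z ++ streamArrivals c (n + 1) z) <+:
      streamBits (fifoEncoder c R) (n + 1) z ++ streamQueue c R (n + 1) z := by
  rw [streamBits_succ, List.append_assoc, List.prefix_append_right_inj, streamQueue_succ]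
  have hch : streamChunk (fifoEncoder c R) n z = List.ofFn fun m : Fin (numBits R (n + 1)) =>
      (streamQueue c R n z ++ streamArrivals c (n + 1) z).getD m false := rfl
  rw [hch]
  generalize streamQueue c R n z ++ streamArrivals c (n + 1) z = w
  generalize numBits R (n + 1) = k
  refine List.prefix_iff_getElem.2 ⟨by simp; omega, fun i hi => ?_⟩
  rw [List.getElem_append]
  split_ifs with h
  · simp [hi]
  · rw [List.length_ofFn] at h
    simp only [List.getElem_drop, List.length_ofFn]
    congr 1
    omega

lemma streamBits_append_prefix {m n : ℕ} (h : m ≤ n) (z : ℕ → X × Y) :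
    streamBits (fifoEncoder c R) m z ++ streamQueue c R m z <+:
      streamBits (fifoEncoder c R) n z ++ streamQueue c R n z := by
  induction n, h using Nat.le_induction with
  | base => exact List.prefix_rfl
  | succ n _ ih =>
    refine ih.trans (List.IsPrefix.trans ?_ (streamBits_append_prefix_succ n z))
    rw [← List.append_assoc]
    exact List.prefix_append _ _

lemma streamBits_append_blockContent_prefix (hN : 0 < N) {b n : ℕ} (h : b * N + (N - 1) < n)
    (z : ℕ → X × Y) :
    streamBits (fifoEncoder c R) (b * N + (N - 1)) z ++ blockContent c R b z <+:
      streamBits (fifoEncoder c R) n z ++ streamQueue c R n z := by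
  rw [blockContent, ← streamArrivals_block hN]
  exact (streamBits_append_prefix_succ _ z).trans (streamBits_append_prefix h z)

lemma Drained.of_succ (hN : 0 < N) (hR : 0 ≤ R) {b n : ℕ} {z : ℕ → X × Y}
    (h : Drained c R (b + 1) n z) : Drained c R b n z := by
  have hlt : b * N + (N - 1) < (b + 1) * N + (N - 1) := by rw [add_mul, one_mul]; omega
  have hl := (streamBits_append_blockContent_prefix (c := c) (R := R) hN hlt z).length_le
  rw [List.length_append, List.length_append, length_streamBits hR, length_streamBits hR] at hl
  unfold Drained at h ⊢
  rw [blockContent, List.length_append] at h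
  omega

lemma Drained.lt (hc : ∀ x y, c x y ≠ []) (hR : 0 ≤ R) {b n : ℕ} {z : ℕ → X × Y}
    (h : Drained c R b n z) : b * N + (N - 1) < n := by
  by_contra hcon
  have h1 := bitBudget_mono hR (not_lt.1 hcon)
  have h2 : 0 < (blockWord c b z).length := List.length_pos_iff.2 (hc _ _)
  unfold Drained at h
  rw [blockContent, List.length_append] at h
  omega

/-- Once the codeword of block `b` has left the queue, the bits sent and the side-information
determine the source up to the end of block `b`. -/
lemma eq_of_drained (hN : 0 < N) (hR : 0 ≤ R) (hc : ∀ x y, c x y ≠ [])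
    (hpre : ∀ x x' y l, c x y <+: l → c x' y <+: l → x = x') {n : ℕ} {z z' : ℕ → X × Y}
    (hy : ∀ k < n, (z k).2 = (z' k).2)
    (hbits : streamBits (fifoEncoder c R) n z = streamBits (fifoEncoder c R) n z') {b : ℕ}
    (h : Drained c R b n z) (h' : Drained c R b n z') : ∀ k < (b + 1) * N, z k = z' k := by
  -- one block: if the sources agree before block `b`, they agree on it
  have step : ∀ b, Drained c R b n z → Drained c R b n z' → (∀ k < b * N, z k = z' k) →
      ∀ k < (b + 1) * N, z k = z' k := by
    intro b h h' hpast k hk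
    have hlt := h.lt hc hR
    have hQ : streamQueue c R (b * N + (N - 1)) z = streamQueue c R (b * N + (N - 1)) z' :=
      streamQueue_add_dependsOn hR b (by omega) fun i hi => hpast i hi
    have hB := streamBits_eq_of_le hR _ hlt.le hbits
    have sent : ∀ ζ : ℕ → X × Y, Drained c R b n ζ →
        streamBits (fifoEncoder c R) (b * N + (N - 1)) ζ ++ blockContent c R b ζ <+:
          streamBits (fifoEncoder c R) n ζ := fun ζ hζ => by
      refine List.prefix_of_prefix_length_le (streamBits_append_blockContent_prefix hN hlt ζ)
        (List.prefix_append _ _) ?_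
      rw [List.length_append, length_streamBits hR, length_streamBits hR]
      exact hζ
    have s := sent z h
    have s' := sent z' h'
    rw [blockContent, ← List.append_assoc] at s s'
    rw [← hbits, ← hB, ← hQ] at s'
    obtain ⟨l, hl⟩ := (List.prefix_append _ _).trans s
    rw [← hl, List.prefix_append_right_inj] at s s'
    have hyb : (fun k : Fin N => (z' (b * N + k)).2) = fun k : Fin N => (z (b * N + k)).2 := by
      funext k
      exact (hy _ (by have := k.2; omega)).symm
    rw [blockWord, hyb] at s'
    have hx := hpre _ _ _ l s s'
    rcases lt_or_ge k (b * N) with hkb | hkb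
    · exact hpast k hkb
    · have hk' : k - b * N < N := by rw [add_mul, one_mul] at hk; omega
      have e : b * N + (k - b * N) = k := by omega
      have := congr_fun hx ⟨k - b * N, hk'⟩
      simp only [e] at this
      exact Prod.ext this (hy k (by omega))
  induction b with
  | zero => exact step 0 h h' fun k hk => by simp at hk
  | succ b ih =>
    exact step (b + 1) h h' (ih (h.of_succ hN hR) (h'.of_succ hN hR))

open Classical in
/-- The decoder of a block code smoothed by a FIFO queue: it looks for a source that agrees with
the side-information and with the bits received, and for which the relevant codeword has left the
queue. Nothing in it refers to the law of the source. -/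
def fifoDecoder [Nonempty X] (c : (Fin N → X) → (Fin N → Y) → List Bool) (R : ℝ) (Δ : ℕ) :
    Decoder X Y Δ := fun i bits y =>
  if h : ∃ z : ℕ → X × Y, (∀ k : Fin (i + 1 + Δ), (z k).2 = y k) ∧
      streamBits (fifoEncoder c R) (i + 1 + Δ) z = bits ∧ Drained c R (i / N) (i + 1 + Δ) z
  then (h.choose i).1 else Classical.arbitrary X

/-- The only source of errors is a codeword still in the queue at the deadline. -/
lemma not_drained_of_decodedWrong [Fintype X] [Fintype Y] [Nonempty X] [Nonempty Y]
    (hN : 0 < N) (hR : 0 ≤ R) (hc : ∀ x y, c x y ≠ [])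
    (hpre : ∀ x x' y l, c x y <+: l → c x' y <+: l → x = x') {Δ i : ℕ} {z : ℕ → X × Y}
    (h : DecodedWrong (fifoEncoder c R) (fifoDecoder c R Δ) i z) :
    ¬ Drained c R (i / N) (i + 1 + Δ) z := by
  intro hd
  apply h
  have hex : ∃ z' : ℕ → X × Y, (∀ k : Fin (i + 1 + Δ), (z' k).2 = (z k).2) ∧
      streamBits (fifoEncoder c R) (i + 1 + Δ) z' = streamBits (fifoEncoder c R) (i + 1 + Δ) z ∧
      Drained c R (i / N) (i + 1 + Δ) z' := ⟨z, fun _ => rfl, rfl, hd⟩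
  have e := hex.choose_spec
  have := eq_of_drained hN hR hc hpre (fun k hk => e.1 ⟨k, hk⟩) e.2.1 e.2.2 hd i
    (Nat.lt_mul_of_div_lt (Nat.lt_succ_self _) hN)
  unfold fifoDecoder
  rw [dif_pos hex, this]

/-! ### Exponential moments of the backlog -/

section Moments

variable [Fintype X] [Fintype Y] [Nonempty X] [Nonempty Y] {p : X × Y → ℝ}

/-- The exponential moment `E 2^{ρ|c|}` of the length of a codeword. -/
def lengthMoment (c : (Fin N → X) → (Fin N → Y) → List Bool) (p : X × Y → ℝ) (ρ : ℝ) : ℝ :=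
  streamExpect p N fun z =>
    (2 : ℝ) ^ (ρ * ((c (fun k => (z k).1) fun k => (z k).2).length : ℝ))

lemma bitBudget_le (hR : 0 ≤ R) (n : ℕ) : (bitBudget R n : ℝ) ≤ n * R :=
  Nat.floor_le (by positivity)

lemma lt_bitBudget (R : ℝ) (n : ℕ) : n * R - 1 < (bitBudget R n : ℝ) := Nat.sub_one_lt_floor _

lemma streamExpect_blockContent (hN : 0 < N) (hR : 0 ≤ R)
    (ρ : ℝ) (b : ℕ) :
    streamExpect p ((b + 1) * N) (fun z => (2 : ℝ) ^ (ρ * ((blockContent c R b z).length : ℝ))) =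
      streamExpect p (b * N)
          (fun z => (2 : ℝ) ^ (ρ * ((streamQueue c R (b * N + (N - 1)) z).length : ℝ))) *
        lengthMoment c p ρ := by
  rw [add_mul, one_mul, lengthMoment, ← streamExpect_mul_shift]
  · congr 1
    funext z
    rw [blockContent, List.length_append, Nat.cast_add, mul_add, Real.rpow_add two_pos]
    rfl
  · intro z z' h
    have : streamQueue c R (b * N + (N - 1)) z = streamQueue c R (b * N + (N - 1)) z' :=
      streamQueue_add_dependsOn hR b (by omega) h
    simp only [this]

/-- If the moment of the codeword length is well below the moment of the service per block, then
the exponential moments of the backlog stay bounded, by the Lindley recursion. -/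
lemma streamExpect_blockContent_le (hp : p ∈ stdSimplex ℝ (X × Y)) (hN : 0 < N) (hR : 0 ≤ R)
    {ρ : ℝ} (hρ : 0 < ρ) (hG : 2 * lengthMoment c p ρ ≤ 2 ^ (ρ * (N * R - 1))) (b : ℕ) :
    streamExpect p ((b + 1) * N) (fun z => (2 : ℝ) ^ (ρ * ((blockContent c R b z).length : ℝ))) ≤
      2 * lengthMoment c p ρ := by
  have hG0 : 0 ≤ lengthMoment c p ρ := streamExpect_nonneg hp _ fun z => by positivity
  induction b with
  | zero =>
    rw [streamExpect_blockContent hN hR]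
    simp only [streamQueue_block_zero hN hR, List.length_nil, Nat.cast_zero, mul_zero,
      Real.rpow_zero, streamExpect_const hp, one_mul]
    linarith
  | succ b ih =>
    rw [streamExpect_blockContent hN hR]
    have hu : streamExpect p ((b + 1) * N)
        (fun z => (2 : ℝ) ^ (ρ * ((streamQueue c R ((b + 1) * N + (N - 1)) z).length : ℝ))) ≤
        1 + 2 ^ (-(ρ * (N * R - 1))) * (2 * lengthMoment c p ρ) := by
      refine le_trans ?_ (add_le_add_right (mul_le_mul_of_nonneg_left ih (by positivity)) 1)
      rw [← streamExpect_mul_left, ← streamExpect_const hp ((b + 1) * N) 1, ← streamExpect_add]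
      refine streamExpect_mono hp _ fun z => ?_
      rw [length_streamQueue_block_succ hN hR, streamExpect_const hp]
      set W := (blockContent c R b z).length
      have hS : (N : ℝ) * R - 1 ≤
          ((bitBudget R ((b + 1) * N + (N - 1)) - bitBudget R (b * N + (N - 1)) : ℕ) : ℝ) := by
        have hm := bitBudget_mono hR
          (show b * N + (N - 1) ≤ (b + 1) * N + (N - 1) by rw [add_mul]; omega)
        rw [Nat.cast_sub hm]
        have h1 := bitBudget_le hR (b * N + (N - 1))
        have h2 := lt_bitBudget R ((b + 1) * N + (N - 1))
        push_cast at h1 h2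
        nlinarith
      set S := bitBudget R ((b + 1) * N + (N - 1)) - bitBudget R (b * N + (N - 1))
      rcases le_total W S with h | h
      · rw [Nat.sub_eq_zero_of_le h]
        simp only [Nat.cast_zero, mul_zero, Real.rpow_zero]
        have : (0 : ℝ) ≤ 2 ^ (-(ρ * (N * R - 1))) * 2 ^ (ρ * (W : ℝ)) := by positivity
        linarith
      · rw [Nat.cast_sub h, ← Real.rpow_add two_pos]
        have : (2 : ℝ) ^ (ρ * ((W : ℝ) - S)) ≤ 2 ^ (-(ρ * (N * R - 1)) + ρ * (W : ℝ)) :=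
          Real.rpow_le_rpow_of_exponent_le one_le_two (by nlinarith)
        linarith
    have h1 : (2 : ℝ) ^ (-(ρ * (N * R - 1))) * (2 * lengthMoment c p ρ) ≤ 1 := by
      rw [Real.rpow_neg zero_le_two, inv_mul_le_iff₀ (by positivity), mul_one]
      exact hG
    calc _ ≤ (1 + 2 ^ (-(ρ * (N * R - 1))) * (2 * lengthMoment c p ρ)) * lengthMoment c p ρ :=
          mul_le_mul_of_nonneg_right hu hG0
      _ ≤ _ := mul_le_mul_of_nonneg_right (by linarith) hG0

/-- The Chernoff bound for a deadline violation. -/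
lemma errorProb_fifo_le (hp : p ∈ stdSimplex ℝ (X × Y)) (hN : 0 < N) (hR : 0 ≤ R)
    (hc : ∀ x y, c x y ≠ []) (hpre : ∀ x x' y l, c x y <+: l → c x' y <+: l → x = x')
    {ρ : ℝ} (hρ : 0 < ρ) (hG : 2 * lengthMoment c p ρ ≤ 2 ^ (ρ * (N * R - 1))) (i Δ : ℕ) :
    errorProb p (fifoEncoder c R) (fifoDecoder c R Δ) i ≤
      2 ^ (2 * ρ * N * R) * 2 ^ (-(Δ : ℝ) * (ρ * R)) := by
  rw [← Real.rpow_add two_pos]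
  rcases lt_or_ge Δ N with hΔ | hΔ
  · -- a delay shorter than a block: the bound exceeds one
    refine (errorProb_le_one hp _ _ i).trans (Real.one_le_rpow one_le_two ?_)
    have : (Δ : ℝ) ≤ N := by exact_mod_cast hΔ.le
    have : 0 ≤ (2 * (N : ℝ) - Δ) * (ρ * R) :=
      mul_nonneg (by linarith [(Nat.cast_nonneg Δ : (0 : ℝ) ≤ Δ)]) (by positivity)
    linarith
  set b := i / N with hb
  set m := b * N + (N - 1) with hm
  set n := i + 1 + Δ with hn
  have hbi : b * N ≤ i := Nat.div_mul_le_self i N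
  have hexp : ρ * (bitBudget R m : ℝ) - ρ * (bitBudget R n : ℝ) ≤
      ρ * (N * R - Δ * R + 1) := by
    rw [← mul_sub]
    refine mul_le_mul_of_nonneg_left ?_ hρ.le
    have h1 := bitBudget_le hR m
    have h2 := lt_bitBudget R n
    have h3 : (m : ℝ) + Δ ≤ n + N := by exact_mod_cast (by omega : m + Δ ≤ n + N)
    nlinarith
  have hdep : DependsOn (fun z => (2 : ℝ) ^ (ρ * (bitBudget R m : ℝ) - ρ * (bitBudget R n : ℝ)) *
      (2 : ℝ) ^ (ρ * ((blockContent c R b z).length : ℝ))) (Set.Iio ((b + 1) * N)) := by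
    intro z z' h
    have h1 : blockContent c R b z = blockContent c R b z' := by
      have hlt : b * N ≤ (b + 1) * N := by rw [add_mul]; omega
      have hQ : streamQueue c R (b * N + (N - 1)) z = streamQueue c R (b * N + (N - 1)) z' :=
        streamQueue_add_dependsOn hR b (by omega) fun k hk => h k (lt_of_lt_of_le hk hlt)
      have hw : ∀ k : Fin N, z (b * N + k) = z' (b * N + k) := fun k => h _ (by
        have := k.2
        simp only [Set.mem_Iio, add_mul, one_mul]; omega)
      simp only [blockContent, blockWord, hQ, hw]
    simp only [h1]
  rw [errorProb_eq_streamExpect]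
  calc streamExpect p n (errorIndicator (fifoEncoder c R) (fifoDecoder c R Δ) i)
      ≤ streamExpect p n (fun z =>
          (2 : ℝ) ^ (ρ * (bitBudget R m : ℝ) - ρ * (bitBudget R n : ℝ)) *
          (2 : ℝ) ^ (ρ * ((blockContent c R b z).length : ℝ))) := by
        refine streamExpect_mono hp _ fun z => ?_
        unfold errorIndicator
        split_ifs with h
        · have hd := not_drained_of_decodedWrong hN hR hc hpre h
          rw [← Real.rpow_add two_pos]
          refine Real.one_le_rpow one_le_two ?_
          have : (bitBudget R n : ℝ) ≤ bitBudget R m + (blockContent c R b z).length := by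
            exact_mod_cast (not_le.1 hd).le
          nlinarith
        · positivity
    _ = streamExpect p ((b + 1) * N) (fun z =>
          (2 : ℝ) ^ (ρ * (bitBudget R m : ℝ) - ρ * (bitBudget R n : ℝ)) *
          (2 : ℝ) ^ (ρ * ((blockContent c R b z).length : ℝ))) :=
        streamExpect_of_dependsOn hp (by rw [add_mul, one_mul]; omega) hdep
    _ ≤ 2 ^ (ρ * (N * R - Δ * R + 1)) * 2 ^ (ρ * (N * R - 1)) := by
        rw [streamExpect_mul_left]
        exact mul_le_mul (Real.rpow_le_rpow_of_exponent_le one_le_two hexp)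
          ((streamExpect_blockContent_le hp hN hR hρ hG b).trans hG)
          (streamExpect_nonneg hp _ fun z => by positivity) (by positivity)
    _ = _ := by
        rw [← Real.rpow_add two_pos]
        congr 1
        ring

end Moments

end

section

/-! ### Types and the universal type code -/

lemma natBits_injOn {k m n : ℕ} (hm : m < 2 ^ k) (hn : n < 2 ^ k)
    (h : natBits k m = natBits k n) : m = n := by
  have h' := List.ofFn_injective h
  refine Nat.eq_of_testBit_eq fun i => ?_
  rcases lt_or_ge i k with hi | hi
  · exact congr_fun h' ⟨i, hi⟩
  · have hk : 2 ^ k ≤ 2 ^ i := Nat.pow_le_pow_right two_pos hi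
    rw [Nat.testBit_lt_two_pow (hm.trans_le hk), Nat.testBit_lt_two_pow (hn.trans_le hk)]

lemma length_natBits (k n : ℕ) : (natBits k n).length = k := List.length_ofFn

lemma sum_prod_fin {Z : Type*} [Fintype Z] [DecidableEq Z] (N : ℕ) (f : Z → ℝ) :
    ∑ z : Fin N → Z, ∏ k, f (z k) = (∑ a, f a) ^ N := (Fintype.sum_pow f N).symm

variable {X Y : Type*} [Fintype X] [Fintype Y] [DecidableEq X] [DecidableEq Y] {N : ℕ}

lemma sum_jointType (x : Fin N → X) (y : Fin N → Y) (f : X × Y → ℝ) :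
    ∑ a, ((jointType x y a : ℕ) : ℝ) * f a = ∑ k, f (x k, y k) := by
  have h : ∀ a, ((jointType x y a : ℕ) : ℝ) * f a =
      ∑ k, if (x k, y k) = a then f a else 0 := fun a => by
    rw [← Finset.sum_filter, Finset.sum_const, nsmul_eq_mul]; rfl
  rw [Finset.sum_congr rfl fun a _ => h a, Finset.sum_comm]
  simp

lemma sum_empirical (hN : 0 < N) (x : Fin N → X) (y : Fin N → Y) (f : X × Y → ℝ) :
    (N : ℝ) * ∑ a, empirical (jointType x y) a * f a = ∑ k, f (x k, y k) := by
  rw [← sum_jointType, Finset.mul_sum]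
  refine Finset.sum_congr rfl fun a _ => ?_
  have : (N : ℝ) ≠ 0 := by positivity
  rw [empirical]
  field_simp

lemma empirical_mem (hN : 0 < N) (x : Fin N → X) (y : Fin N → Y) :
    empirical (jointType x y) ∈ stdSimplex ℝ (X × Y) := by
  refine ⟨fun a => by unfold empirical; positivity, ?_⟩
  have h := sum_empirical hN x y fun _ => 1
  simp only [mul_one, Finset.sum_const, Finset.card_univ, Fintype.card_fin, nsmul_eq_mul] at h
  have hN' : (N : ℝ) ≠ 0 := by positivity
  exact mul_left_cancel₀ hN' (by rw [h, mul_one])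

lemma empirical_pos (hN : 0 < N) (x : Fin N → X) (y : Fin N → Y) (k : Fin N) :
    0 < empirical (jointType x y) (x k, y k) := by
  unfold empirical jointType
  have : 0 < (Finset.univ.filter fun j => (x j, y j) = (x k, y k)).card :=
    Finset.card_pos.2 ⟨k, by simp⟩
  have hN' : (0 : ℝ) < N := by exact_mod_cast hN
  exact div_pos (by exact_mod_cast this) hN'

lemma exists_of_empirical_ne_zero {x : Fin N → X} {y : Fin N → Y} {a : X × Y}
    (h : empirical (jointType x y) a ≠ 0) : ∃ k, (x k, y k) = a := by
  by_contra hcon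
  push Not at hcon
  apply h
  have : (Finset.univ.filter fun j => (x j, y j) = a) = ∅ :=
    Finset.filter_eq_empty_iff.2 fun k _ => hcon k
  simp [empirical, jointType, this]

/-- The probability of a block under a product law depends on its type only. -/
lemma prod_eq_two_rpow (hN : 0 < N) {x : Fin N → X} {y : Fin N → Y} {f : X × Y → ℝ}
    (hf : ∀ k, 0 < f (x k, y k)) : ∏ k, f (x k, y k) =
      2 ^ ((N : ℝ) * ∑ a, empirical (jointType x y) a * Real.logb 2 (f a)) := by
  rw [sum_empirical hN x y fun a => Real.logb 2 (f a), Real.rpow_sum_of_pos two_pos]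
  refine Finset.prod_congr rfl fun k _ => ?_
  rw [Real.rpow_logb two_pos (by norm_num) (hf k)]

/-- A conditional type class has at most `2^{N H(x|y)}` elements. -/
lemma card_typeClass_le (hN : 0 < N) (x : Fin N → X) (y : Fin N → Y) :
    ((typeClass (jointType x y) y).card : ℝ) ≤
      2 ^ ((N : ℝ) * condEntropy (empirical (jointType x y))) := by
  set q := empirical (jointType x y) with hq
  have hq0 : ∀ a, 0 ≤ q a := (empirical_mem hN x y).1
  set w : X × Y → ℝ := fun a => q a / marginal q a.2
  have hw0 : ∀ a, 0 ≤ w a := fun a => div_nonneg (hq0 a) (marginal_nonneg hq0 _)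
  have hconst : ∀ x' ∈ typeClass (jointType x y) y, ∏ k, w (x' k, y k) =
      2 ^ (-((N : ℝ) * condEntropy q)) := fun x' hx' => by
    have ht : jointType x' y = jointType x y := by simpa [typeClass] using hx'
    rw [prod_eq_two_rpow hN, ht, ← mul_neg]
    · congr 2
      exact (neg_neg _).symm
    · intro k
      have h1 : 0 < q (x' k, y k) := by rw [hq, ← ht]; exact empirical_pos hN x' y k
      exact div_pos h1 (h1.trans_le (le_marginal hq0 _))
  have h1 : ((typeClass (jointType x y) y).card : ℝ) * 2 ^ (-((N : ℝ) * condEntropy q)) ≤ 1 := by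
    rw [← nsmul_eq_mul, ← Finset.sum_const, ← Finset.sum_congr rfl hconst]
    calc ∑ x' ∈ typeClass (jointType x y) y, ∏ k, w (x' k, y k)
        ≤ ∑ x' : Fin N → X, ∏ k, w (x' k, y k) :=
          Finset.sum_le_univ_sum_of_nonneg fun x' => Finset.prod_nonneg fun k _ => hw0 _
      _ = ∏ k, ∑ x', w (x', y k) := by
          rw [Finset.prod_univ_sum, Fintype.piFinset_univ]
      _ ≤ 1 := Finset.prod_le_one (fun k _ => Finset.sum_nonneg fun x' _ => hw0 _) fun k _ => by
          simp only [w]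
          rw [← Finset.sum_div]
          exact div_self_le_one _
  rwa [Real.rpow_neg zero_le_two, mul_inv_le_iff₀ (by positivity), one_mul] at h1

lemma card_types (N : ℕ) : Fintype.card (X × Y → Fin (N + 1)) =
    (N + 1) ^ (Fintype.card X * Fintype.card Y) := by
  simp [Fintype.card_prod]

lemma typeCode_ne_nil (x : Fin N → X) (y : Fin N → Y) : typeCode N x y ≠ [] :=
  List.cons_ne_nil _ _

lemma equivFin_typeClass_congr {t t' : X × Y → Fin (N + 1)} {y : Fin N → Y} (h : t = t')
    {x : Fin N → X} (hx : x ∈ typeClass t y) (hx' : x ∈ typeClass t' y) :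
    ((typeClass t y).equivFin ⟨x, hx⟩ : ℕ) = (typeClass t' y).equivFin ⟨x, hx'⟩ := by
  subst h; rfl

/-- Given the side-information, the type code is uniquely decodable from any continuation. -/
lemma typeCode_prefix (hN : 0 < N) (x x' : Fin N → X) (y : Fin N → Y) (l : List Bool)
    (h : typeCode N x y <+: l) (h' : typeCode N x' y <+: l) : x = x' := by
  have split : ∀ {A A' B B' l : List Bool}, A.length = A'.length → A ++ B <+: l →
      A' ++ B' <+: l → A = A' ∧ ∃ l', B <+: l' ∧ B' <+: l' := by
    intro A A' B B' l hl h h'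
    obtain ⟨l₁, rfl⟩ := h
    obtain ⟨l₂, h'⟩ := h'
    rw [List.append_assoc, List.append_assoc] at h'
    obtain ⟨h1, h2⟩ := List.append_inj h' hl.symm
    exact ⟨h1.symm, B ++ l₁, List.prefix_append _ _, h2 ▸ List.prefix_append _ _⟩
  unfold typeCode at h h'
  rw [← List.singleton_append] at h h'
  obtain ⟨-, l₁, h1, h1'⟩ := split rfl h h'
  obtain ⟨htype, l₂, h2, h2'⟩ := split (by rw [length_natBits, length_natBits]) h1 h1'
  have hlt : ∀ t : X × Y → Fin (N + 1), (Fintype.equivFin (X × Y → Fin (N + 1)) t : ℕ) <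
      2 ^ Nat.clog 2 ((N + 1) ^ (Fintype.card X * Fintype.card Y)) := fun t =>
    (Fin.is_lt _).trans_le (card_types (X := X) (Y := Y) N ▸ Nat.le_pow_clog one_lt_two _)
  have ht : jointType x' y = jointType x y := by
    have := natBits_injOn (hlt _) (hlt _) htype
    exact ((Fintype.equivFin _).injective (Fin.ext this)).symm
  have hx' : x' ∈ typeClass (jointType x y) y := by simp [typeClass, ht]
  rw [equivFin_typeClass_congr ht (by simp [typeClass]) hx', ht] at h2'
  rw [← List.append_nil (natBits _ _)] at h2 h2'
  obtain ⟨hidx, -⟩ := split (by rw [length_natBits, length_natBits]) h2 h2'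
  have hcard : (typeClass (jointType x y) y).card ≤
      2 ^ ⌈(N : ℝ) * condEntropy (empirical (jointType x y))⌉₊ := by
    have := (card_typeClass_le hN x y).trans
      (Real.rpow_le_rpow_of_exponent_le one_le_two (Nat.le_ceil _))
    rw [Real.rpow_natCast] at this
    exact_mod_cast this
  have := natBits_injOn ((Fin.is_lt _).trans_le hcard) ((Fin.is_lt _).trans_le hcard) hidx
  exact congr_arg Subtype.val ((typeClass (jointType x y) y).equivFin.injective (Fin.ext this))

lemma two_pow_clog_le (m : ℕ) (hm : 0 < m) : (2 : ℝ) ^ Nat.clog 2 m ≤ 2 * m := by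
  have : 2 ^ Nat.clog 2 m ≤ 2 * m := by
    rcases Nat.lt_or_ge 1 m with h | h
    · have h1 := Nat.pow_pred_clog_lt_self one_lt_two h
      have h2 := Nat.clog_pos one_lt_two h
      obtain ⟨j, hj⟩ := Nat.exists_eq_succ_of_ne_zero h2.ne'
      rw [hj, Nat.succ_eq_add_one, Nat.pred_succ] at h1
      rw [hj, pow_succ]
      omega
    · rw [Nat.clog_of_right_le_one h]; omega
  exact_mod_cast this

lemma two_rpow_length_typeCode_le (hN : 0 < N) {ρ : ℝ} (hρ : 0 < ρ) (x : Fin N → X)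
    (y : Fin N → Y) : (2 : ℝ) ^ (ρ * ((typeCode N x y).length : ℝ)) ≤
      (8 * ((N : ℝ) + 1) ^ (Fintype.card X * Fintype.card Y)) ^ ρ *
        2 ^ (ρ * (N * condEntropy (empirical (jointType x y)))) := by
  set m := (N + 1) ^ (Fintype.card X * Fintype.card Y) with hm
  set H := condEntropy (empirical (jointType x y))
  have hH : 0 ≤ (N : ℝ) * H :=
    mul_nonneg (Nat.cast_nonneg _) (condEntropy_nonneg (empirical_mem hN x y).1)
  have hlen : ((typeCode N x y).length : ℝ) = Nat.clog 2 m + ⌈(N : ℝ) * H⌉₊ + 1 := by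
    unfold typeCode
    rw [List.length_cons, List.length_append, length_natBits, length_natBits]
    push_cast
    rfl
  have hceil := (Nat.ceil_lt_add_one hH).le
  have h8 : (2 : ℝ) ^ ((Nat.clog 2 m : ℝ) + 2) ≤
      8 * ((N : ℝ) + 1) ^ (Fintype.card X * Fintype.card Y) := by
    have h := two_pow_clog_le m (by positivity)
    rw [Real.rpow_add two_pos, Real.rpow_natCast]
    have e : (m : ℝ) = ((N : ℝ) + 1) ^ (Fintype.card X * Fintype.card Y) := by
      rw [hm]; push_cast; rfl
    rw [← e]
    norm_num
    linarith
  calc (2 : ℝ) ^ (ρ * ((typeCode N x y).length : ℝ))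
      ≤ 2 ^ (((Nat.clog 2 m : ℝ) + 2) * ρ + ρ * (N * H)) :=
        Real.rpow_le_rpow_of_exponent_le one_le_two (by rw [hlen]; nlinarith)
    _ = (2 ^ ((Nat.clog 2 m : ℝ) + 2)) ^ ρ * 2 ^ (ρ * (N * H)) := by
        rw [Real.rpow_add two_pos, Real.rpow_mul zero_le_two]
    _ ≤ _ := mul_le_mul_of_nonneg_right (Real.rpow_le_rpow (by positivity) h8 hρ.le)
        (by positivity)

variable [Nonempty X] [Nonempty Y] {p : X × Y → ℝ}

/-- The exponential moment of the empirical conditional entropy, by the method of types. -/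
lemma sum_prod_mul_two_rpow_le (hp : IsSource p) (hN : 0 < N) {ρ : ℝ} (hρ : 0 < ρ) :
    ∑ z : Fin N → X × Y, (∏ k, p (z k)) * (2 : ℝ) ^ (ρ * (N * condEntropy
        (empirical (jointType (fun k => (z k).1) fun k => (z k).2)))) ≤
      ((N : ℝ) + 1) ^ (Fintype.card X * Fintype.card Y) * 2 ^ (N * gallager p ρ) := by
  classical
  set T : Finset (X × Y → Fin (N + 1)) :=
    Finset.univ.filter fun t => empirical t ∈ stdSimplex ℝ (X × Y) with hT
  calc _ ≤ ∑ z : Fin N → X × Y, (∑ t ∈ T, ∏ k, empirical t (z k)) * 2 ^ (N * gallager p ρ) := by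
        refine Finset.sum_le_sum fun z _ => ?_
        set x := fun k => (z k).1
        set y := fun k => (z k).2
        set q := empirical (jointType x y) with hq
        have hqm := empirical_mem hN x y
        have hle : ∏ k, q (z k) ≤ ∑ t ∈ T, ∏ k, empirical t (z k) := by
          refine Finset.single_le_sum (f := fun t => ∏ k, empirical t (z k))
            (fun t _ => Finset.prod_nonneg fun k _ => ?_)
            (Finset.mem_filter.2 ⟨Finset.mem_univ (jointType x y), hqm⟩)
          unfold empirical; positivity
        refine le_trans ?_ (mul_le_mul_of_nonneg_right hle (by positivity))
        by_cases h0 : ∀ k, p (z k) ≠ 0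
        · have hpos : ∀ k, 0 < p (x k, y k) := fun k => (hp.1.1 _).lt_of_ne (h0 k).symm
          have hac : ∀ a, p a = 0 → q a = 0 := fun a ha => by
            by_contra hne
            obtain ⟨k, rfl⟩ := exists_of_empirical_ne_zero hne
            exact (hpos k).ne' ha
          have e1 : ∏ k, p (z k) = _ := prod_eq_two_rpow hN hpos
          have e2 : ∏ k, q (z k) = _ := prod_eq_two_rpow hN (empirical_pos hN x y)
          have hD : divergence q p =
              ∑ a, q a * Real.logb 2 (q a) - ∑ a, q a * Real.logb 2 (p a) := by
            rw [divergence, ← Finset.sum_sub_distrib]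
            refine Finset.sum_congr rfl fun a _ => ?_
            rcases eq_or_ne (q a) 0 with h | h
            · simp [h]
            · rw [Real.logb_div h fun h' => h (hac a h'), mul_sub]
          have v := mul_condEntropy_sub_divergence_le hp (ρ := ρ) (by linarith) hqm hac
          rw [e1, e2, ← Real.rpow_add two_pos, ← Real.rpow_add two_pos]
          refine Real.rpow_le_rpow_of_exponent_le one_le_two ?_
          have := mul_le_mul_of_nonneg_left v (Nat.cast_nonneg N)
          rw [← hq] at *
          rw [hD] at this
          linarith
        · push Not at h0
          obtain ⟨k, hk⟩ := h0
          rw [Finset.prod_eq_zero (Finset.mem_univ k) hk, zero_mul]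
          exact mul_nonneg (Finset.prod_nonneg fun k _ => hqm.1 _) (by positivity)
    _ = (T.card : ℝ) * 2 ^ (N * gallager p ρ) := by
        rw [← Finset.sum_mul, Finset.sum_comm]
        congr 1
        rw [Finset.cast_card]
        refine Finset.sum_congr rfl fun t ht => ?_
        rw [sum_prod_fin, (Finset.mem_filter.1 ht).2.2, one_pow]
    _ ≤ _ := by
        refine mul_le_mul_of_nonneg_right ?_ (by positivity)
        have h : T.card ≤ (N + 1) ^ (Fintype.card X * Fintype.card Y) :=
          card_types (X := X) (Y := Y) N ▸ Finset.card_le_univ T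
        exact_mod_cast h

lemma lengthMoment_typeCode_le (hp : IsSource p) (hN : 0 < N) {ρ : ℝ} (hρ : 0 < ρ) :
    lengthMoment (typeCode N) p ρ ≤
      (8 * ((N : ℝ) + 1) ^ (Fintype.card X * Fintype.card Y)) ^ ρ *
        (((N : ℝ) + 1) ^ (Fintype.card X * Fintype.card Y) * 2 ^ (N * gallager p ρ)) := by
  rw [lengthMoment, streamExpect_eq_sum]
  refine le_trans ?_ (mul_le_mul_of_nonneg_left (sum_prod_mul_two_rpow_le hp hN hρ)
    (by positivity))
  rw [Finset.mul_sum]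
  refine Finset.sum_le_sum fun z _ => ?_
  simp only [streamExtend_apply]
  refine (mul_le_mul_of_nonneg_left (two_rpow_length_typeCode_le hN hρ _ _)
    (Finset.prod_nonneg fun k _ => hp.1.1 _)).trans_eq ?_
  ring

/-- The type code is short enough, in the sense of exponential moments, for all large blocks. -/
lemma eventually_lengthMoment_typeCode_le (hp : IsSource p) {ρ R : ℝ} (hρ : 0 < ρ)
    (h : gallager p ρ < ρ * R) :
    ∀ᶠ N : ℕ in atTop, 2 * lengthMoment (typeCode N) p ρ ≤ 2 ^ (ρ * (N * R - 1)) := by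
  set d := Fintype.card X * Fintype.card Y with hd
  set δ := ρ * R - gallager p ρ with hδ
  have hδ0 : 0 < δ := sub_pos.2 h
  have hlog : 0 < Real.log 2 := Real.log_pos one_lt_two
  have hε : (0 : ℝ) < 2 ^ (-ρ - δ) / (2 * 8 ^ ρ) := by positivity
  have hlim : Tendsto (fun N : ℕ => (N : ℝ) + 1) atTop atTop :=
    tendsto_atTop_add_const_right _ _ tendsto_natCast_atTop_atTop
  have hev := hlim.eventually ((isLittleO_rpow_exp_pos_mul_atTop ((d : ℝ) * ρ + d)
    (mul_pos hlog hδ0)).bound hε)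
  filter_upwards [hev, eventually_gt_atTop 0] with N hN hN0
  have hN1 : (0 : ℝ) < (N : ℝ) + 1 := by positivity
  rw [Real.norm_of_nonneg (by positivity), Real.norm_of_nonneg (by positivity),
    mul_assoc (Real.log 2), ← Real.rpow_def_of_pos two_pos] at hN
  have e1 : (8 * ((N : ℝ) + 1) ^ d) ^ ρ * ((N : ℝ) + 1) ^ d =
      8 ^ ρ * ((N : ℝ) + 1) ^ ((d : ℝ) * ρ + d) := by
    rw [Real.mul_rpow (by norm_num) (by positivity), Real.rpow_add hN1, Real.rpow_mul hN1.le,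
      Real.rpow_natCast, mul_assoc]
  calc 2 * lengthMoment (typeCode N) p ρ
      ≤ 2 * (8 ^ ρ * ((N : ℝ) + 1) ^ ((d : ℝ) * ρ + d)) * 2 ^ (N * gallager p ρ) := by
        have := lengthMoment_typeCode_le hp hN0 hρ
        rw [← mul_assoc, e1] at this
        linarith
    _ ≤ 2 * (8 ^ ρ * (2 ^ (-ρ - δ) / (2 * 8 ^ ρ) * 2 ^ (δ * ((N : ℝ) + 1)))) *
          2 ^ (N * gallager p ρ) := by gcongr
    _ = 2 ^ (-ρ - δ) * 2 ^ (δ * ((N : ℝ) + 1)) * 2 ^ (N * gallager p ρ) := by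
        field_simp
    _ = _ := by
        rw [← Real.rpow_add two_pos, ← Real.rpow_add two_pos]
        congr 1
        rw [hδ]; ring

/-! ### Universal achievability -/

/-- For all large block-lengths the universal scheme has an error exponent above `s`, with a
constant that is exponential in the block-length only. -/
lemma exists_errorProb_typeCode_le (hp : IsSource p) {R s : ℝ} (hR : condEntropy p < R)
    (hs : (s : EReal) < focusingBound p R) : ∃ ρ, 0 < ρ ∧ s < ρ * R ∧ ∃ N₀ : ℕ, ∀ N : ℕ, N₀ ≤ N →
      ∀ i Δ : ℕ, errorProb p (fifoEncoder (typeCode N) R) (fifoDecoder (typeCode N) R Δ) i ≤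
        2 ^ (2 * ρ * N * R) * 2 ^ (-(Δ : ℝ) * (ρ * R)) := by
  have hR0 : 0 ≤ R := (condEntropy_nonneg hp.1.1).trans hR.le
  obtain ⟨ρ, hρ, h1, h2⟩ := exists_gallager_lt_mul hp hR hs
  obtain ⟨N₀, hN₀⟩ := eventually_atTop.1
    ((eventually_lengthMoment_typeCode_le hp hρ h1).and (eventually_gt_atTop 0))
  exact ⟨ρ, hρ, h2, N₀, fun N hN i Δ => errorProb_fifo_le hp.1 (hN₀ N hN).2 hR0
    typeCode_ne_nil (typeCode_prefix (hN₀ N hN).2) hρ (hN₀ N hN).1 i Δ⟩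

lemma exists_errorProb_typeCode_le_of_fixed (hp : IsSource p) {R s : ℝ} (hR : condEntropy p < R)
    (hs : (s : EReal) < focusingBound p R) : ∃ N₀ : ℕ, ∀ N : ℕ, N₀ ≤ N → ∃ K : ℝ, ∀ i Δ : ℕ,
      0 < Δ → errorProb p (fifoEncoder (typeCode N) R) (fifoDecoder (typeCode N) R Δ) i ≤
        K * (2 : ℝ) ^ (-(Δ : ℝ) * s) := by
  obtain ⟨ρ, hρ, h, N₀, hN₀⟩ := exists_errorProb_typeCode_le hp hR hs
  refine ⟨N₀, fun N hN => ⟨2 ^ (2 * ρ * N * R), fun i Δ _ => (hN₀ N hN i Δ).trans ?_⟩⟩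
  refine mul_le_mul_of_nonneg_left (Real.rpow_le_rpow_of_exponent_le one_le_two ?_)
    (by positivity)
  have : (0 : ℝ) ≤ Δ := Nat.cast_nonneg _
  nlinarith

lemma tendsto_sqrt_div : Tendsto (fun Δ : ℕ => (Nat.sqrt Δ : ℝ) / Δ) atTop (𝓝 0) := by
  have h : Tendsto (fun Δ : ℕ => (1 : ℝ) / Real.sqrt Δ) atTop (𝓝 0) :=
    tendsto_const_nhds.div_atTop (Real.tendsto_sqrt_atTop.comp tendsto_natCast_atTop_atTop)
  refine squeeze_zero (fun Δ => by positivity) (fun Δ => ?_) h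
  rcases Nat.eq_zero_or_pos Δ with rfl | hΔ
  · simp
  have hΔ' : (0 : ℝ) < Δ := by exact_mod_cast hΔ
  have : (Nat.sqrt Δ : ℝ) ≤ Real.sqrt Δ := Real.nat_sqrt_le_real_sqrt
  rw [div_le_div_iff₀ hΔ' (Real.sqrt_pos.2 hΔ'), one_mul]
  calc (Nat.sqrt Δ : ℝ) * Real.sqrt Δ ≤ Real.sqrt Δ * Real.sqrt Δ :=
        mul_le_mul_of_nonneg_right this (Real.sqrt_nonneg _)
    _ = Δ := Real.mul_self_sqrt hΔ'.le

lemma tendsto_sqrt_atTop : Tendsto Nat.sqrt atTop atTop :=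
  tendsto_atTop.2 fun b => by
    filter_upwards [eventually_ge_atTop (b * b)] with n hn
    exact Nat.le_sqrt.2 hn

/-- With the block-length `⌊√Δ⌋` the universal scheme attains the focusing bound. -/
lemma achieves_typeCode_sqrt (hp : IsSource p) {R : ℝ} (hR : condEntropy p < R) :
    Achieves p R (fun Δ => fifoEncoder (typeCode (Nat.sqrt Δ)) R)
      (fun Δ => fifoDecoder (typeCode (Nat.sqrt Δ)) R Δ) (focusingBound p R) := by
  intro s hs
  have hR0 : 0 ≤ R := (condEntropy_nonneg hp.1.1).trans hR.le
  obtain ⟨ρ, hρ, h, N₀, hN₀⟩ := exists_errorProb_typeCode_le hp hR hs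
  -- the loss `2ρ√Δ R` in the exponent is absorbed by the gap between `s` and `ρR` for large `Δ`
  have hgap : ∀ᶠ Δ : ℕ in atTop, 2 * ρ * (Nat.sqrt Δ : ℝ) * R - Δ * (ρ * R) ≤ -Δ * s := by
    have hev : ∀ᶠ Δ : ℕ in atTop, 2 * ρ * R * ((Nat.sqrt Δ : ℝ) / Δ) < ρ * R - s := by
      have := tendsto_sqrt_div.const_mul (2 * ρ * R)
      rw [mul_zero] at this
      exact this.eventually (gt_mem_nhds (sub_pos.2 h))
    filter_upwards [hev, eventually_gt_atTop 0] with Δ hΔ h0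
    have h0' : (0 : ℝ) < Δ := by exact_mod_cast h0
    rw [← mul_div_assoc, div_lt_iff₀ h0'] at hΔ
    linarith
  obtain ⟨Δ₀, hΔ₀⟩ := eventually_atTop.1
    (hgap.and (tendsto_sqrt_atTop.eventually (eventually_ge_atTop N₀)))
  refine ⟨2 ^ ((Δ₀ : ℝ) * |s|), fun i Δ _ => ?_⟩
  have hK : (1 : ℝ) ≤ 2 ^ ((Δ₀ : ℝ) * |s|) := Real.one_le_rpow one_le_two (by positivity)
  rcases lt_or_ge Δ Δ₀ with hΔ | hΔ
  · refine (errorProb_le_one hp.1 _ _ i).trans ?_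
    rw [← Real.rpow_add two_pos]
    refine Real.one_le_rpow one_le_two ?_
    have h1 : (Δ : ℝ) ≤ Δ₀ := by exact_mod_cast hΔ.le
    have h3 : (Δ : ℝ) * s ≤ Δ * |s| :=
      mul_le_mul_of_nonneg_left (le_abs_self s) (Nat.cast_nonneg _)
    have h4 : (Δ : ℝ) * |s| ≤ Δ₀ * |s| := mul_le_mul_of_nonneg_right h1 (abs_nonneg s)
    linarith
  · refine (hN₀ _ (hΔ₀ Δ hΔ).2 i Δ).trans ?_
    rw [← Real.rpow_add two_pos]
    refine le_trans (Real.rpow_le_rpow_of_exponent_le one_le_two ?_)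
      (le_mul_of_one_le_left (by positivity) hK)
    have := (hΔ₀ Δ hΔ).1
    linarith

end

section

/-! ### The weak law of large numbers for finite alphabets -/

section Chebyshev

variable {Z : Type*} [Fintype Z] [Nonempty Z] {q : Z → ℝ}

lemma streamExpect_sum_range (hq : q ∈ stdSimplex ℝ Z) {ψ : Z → ℝ} (hψ : ∑ a, q a * ψ a = 0)
    (n : ℕ) : streamExpect q n (fun z => ∑ k ∈ Finset.range n, ψ (z k)) = 0 := by
  induction n with
  | zero => simp [streamExpect]
  | succ n ih =>
    simp only [streamExpect, Finset.sum_range_succ', streamCons, streamExpect_add, ih,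
      streamExpect_const hq, zero_add]
    exact hψ

lemma streamExpect_sq_sum_range (hq : q ∈ stdSimplex ℝ Z) {ψ : Z → ℝ}
    (hψ : ∑ a, q a * ψ a = 0) (n : ℕ) :
    streamExpect q n (fun z => (∑ k ∈ Finset.range n, ψ (z k)) ^ 2) =
      n * ∑ a, q a * ψ a ^ 2 := by
  induction n with
  | zero => simp [streamExpect]
  | succ n ih =>
    have h : ∀ a, streamExpect q n
        (fun z => (∑ k ∈ Finset.range n, ψ (z k) + ψ a) ^ 2) =
        n * ∑ a, q a * ψ a ^ 2 + ψ a ^ 2 := fun a => by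
      have e : (fun z : ℕ → Z => (∑ k ∈ Finset.range n, ψ (z k) + ψ a) ^ 2) = fun z =>
          (∑ k ∈ Finset.range n, ψ (z k)) ^ 2 +
            (2 * ψ a * ∑ k ∈ Finset.range n, ψ (z k) + ψ a ^ 2) := by
        funext z; ring
      rw [e, streamExpect_add, streamExpect_add, streamExpect_mul_left, ih,
        streamExpect_sum_range hq hψ, streamExpect_const hq, mul_zero, zero_add]
    simp only [streamExpect, Finset.sum_range_succ', streamCons, h, mul_add,
      Finset.sum_add_distrib]
    rw [← Finset.sum_mul, hq.2]
    push_cast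
    ring

/-- The variance of a sum of iid variables. -/
lemma sum_prod_mul_sq (hq : q ∈ stdSimplex ℝ Z) (φ : Z → ℝ) (n : ℕ) :
    ∑ u : Fin n → Z, (∏ k, q (u k)) * (∑ k, (φ (u k) - ∑ a, q a * φ a)) ^ 2 =
      n * ∑ a, q a * (φ a - ∑ a, q a * φ a) ^ 2 := by
  have h0 : ∑ a, q a * (φ a - ∑ b, q b * φ b) = 0 := by
    simp only [mul_sub, Finset.sum_sub_distrib]
    rw [← Finset.sum_mul, hq.2]; ring
  rw [← streamExpect_sq_sum_range hq h0 n, streamExpect_eq_sum]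
  refine Finset.sum_congr rfl fun u _ => ?_
  rw [Finset.sum_range]
  simp only [streamExtend_apply]

end Chebyshev

/-! ### The converse -/

variable {X Y : Type*} [Fintype X] [Fintype Y] [Nonempty X] [Nonempty Y] {p q : X × Y → ℝ}

/-- The sum of the variances of the two log-likelihood ratios that govern the converse. -/
def converseVariance (q p : X × Y → ℝ) : ℝ :=
  ∑ a, q a * (Real.logb 2 (q a / p a) - ∑ a, q a * Real.logb 2 (q a / p a)) ^ 2 +
    ∑ a, q a * (Real.logb 2 (q a / marginal q a.2) -
      ∑ a, q a * Real.logb 2 (q a / marginal q a.2)) ^ 2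

lemma sum_prod_marginal_le (hq : q ∈ stdSimplex ℝ (X × Y)) {n : ℕ}
    (C : Set (Fin n → X × Y)) [DecidablePred (· ∈ C)] {B : ℝ}
    (hC : ∀ y : Fin n → Y,
      ((Finset.univ.filter fun x : Fin n → X => (fun k => (x k, y k)) ∈ C).card : ℝ) ≤ B) :
    ∑ u : Fin n → X × Y, (if u ∈ C then ∏ k, marginal q (u k).2 else 0) ≤ B := by
  classical
  rw [← (Equiv.arrowProdEquivProdArrow (Fin n) (fun _ => X) fun _ => Y).symm.sum_comp,
    Fintype.sum_prod_type_right]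
  calc _ = ∑ y : Fin n → Y, (∏ k, marginal q (y k)) *
        ((Finset.univ.filter fun x : Fin n → X => (fun k => (x k, y k)) ∈ C).card : ℝ) := by
        refine Finset.sum_congr rfl fun y _ => ?_
        rw [mul_comm, ← nsmul_eq_mul, ← Finset.sum_const, Finset.sum_filter]
        rfl
    _ ≤ ∑ y : Fin n → Y, (∏ k, marginal q (y k)) * B :=
        Finset.sum_le_sum fun y _ => mul_le_mul_of_nonneg_left (hC y)
          (Finset.prod_nonneg fun k _ => marginal_nonneg hq.1 _)
    _ = B := by
        rw [← Finset.sum_mul, sum_prod_fin, sum_marginal, hq.2, one_pow, one_mul]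

/-- A block converse with a change of measure: a set that contains few blocks for each
side-information has small probability under `q`, and the typical blocks of `q` outside it have
probability about `2^{-n D(q‖p)}` under `p`. -/
lemma block_converse (hp : p ∈ stdSimplex ℝ (X × Y)) (hq : q ∈ stdSimplex ℝ (X × Y))
    (hac : ∀ a, p a = 0 → q a = 0) {n : ℕ} (hn : 0 < n) {ε : ℝ} (hε : 0 < ε)
    (C : Set (Fin n → X × Y)) [DecidablePred (· ∈ C)] {B : ℝ}
    (hC : ∀ y : Fin n → Y,
      ((Finset.univ.filter fun x : Fin n → X => (fun k => (x k, y k)) ∈ C).card : ℝ) ≤ B) :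
    1 - converseVariance q p / (n * ε ^ 2) - B * 2 ^ (-(n * (condEntropy q - ε))) ≤
      2 ^ (n * (divergence q p + ε)) *
        ∑ u : Fin n → X × Y, if u ∈ C then 0 else ∏ k, p (u k) := by
  classical
  set D := divergence q p with hD
  set H := condEntropy q with hH
  set S₁ : (Fin n → X × Y) → ℝ := fun u => ∑ k, (Real.logb 2 (q (u k) / p (u k)) -
    ∑ a, q a * Real.logb 2 (q a / p a)) with hS₁
  set S₂ : (Fin n → X × Y) → ℝ := fun u => ∑ k, (Real.logb 2 (q (u k) / marginal q (u k).2) -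
    ∑ a : X × Y, q a * Real.logb 2 (q a / marginal q a.2)) with hS₂
  have hn' : (0 : ℝ) < n := by exact_mod_cast hn
  have hpoint : ∀ u : Fin n → X × Y, ∏ k, q (u k) ≤
      2 ^ (n * (D + ε)) * (if u ∈ C then 0 else ∏ k, p (u k)) +
      2 ^ (-(n * (H - ε))) * (if u ∈ C then ∏ k, marginal q (u k).2 else 0) +
      ((∏ k, q (u k)) * S₁ u ^ 2 + (∏ k, q (u k)) * S₂ u ^ 2) / (n * ε) ^ 2 := by
    intro u
    have hq0 : 0 ≤ ∏ k, q (u k) := Finset.prod_nonneg fun k _ => hq.1 _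
    have hp0 : 0 ≤ ∏ k, p (u k) := Finset.prod_nonneg fun k _ => hp.1 _
    have hm0 : 0 ≤ ∏ k, marginal q (u k).2 :=
      Finset.prod_nonneg fun k _ => marginal_nonneg hq.1 _
    have t1 : 0 ≤ 2 ^ (n * (D + ε)) * (if u ∈ C then 0 else ∏ k, p (u k)) :=
      mul_nonneg (by positivity) (by split_ifs <;> positivity)
    have t2 : 0 ≤ 2 ^ (-(n * (H - ε))) * (if u ∈ C then ∏ k, marginal q (u k).2 else 0) :=
      mul_nonneg (by positivity) (by split_ifs <;> positivity)
    have t3 : 0 ≤ ((∏ k, q (u k)) * S₁ u ^ 2 + (∏ k, q (u k)) * S₂ u ^ 2) / (n * ε) ^ 2 := by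
      positivity
    rcases hq0.eq_or_lt with h0 | h0
    · rw [← h0] at t3 ⊢
      linarith
    have hqk : ∀ k, 0 < q (u k) := fun k => (hq.1 _).lt_of_ne fun h =>
      h0.ne' (Finset.prod_eq_zero (Finset.mem_univ k) h.symm)
    have hpk : ∀ k, 0 < p (u k) := fun k => (hp.1 _).lt_of_ne fun h =>
      (hqk k).ne' (hac _ h.symm)
    have hmk : ∀ k, 0 < marginal q (u k).2 := fun k => (hqk k).trans_le (le_marginal hq.1 _)
    have hatyp : ∀ S : ℝ, n * ε ≤ |S| → ∏ k, q (u k) ≤ (∏ k, q (u k)) * S ^ 2 / (n * ε) ^ 2 := by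
      intro S hS
      rw [le_div_iff₀ (by positivity)]
      refine mul_le_mul_of_nonneg_left ?_ hq0
      rw [← sq_abs S]
      gcongr
    have hratio : ∀ w : X × Y → ℝ, (∀ k, 0 < w (u k)) → ∏ k, q (u k) =
        2 ^ (∑ k, Real.logb 2 (q (u k) / w (u k))) * ∏ k, w (u k) := by
      intro w hw
      rw [Real.rpow_sum_of_pos two_pos, ← Finset.prod_mul_distrib]
      refine Finset.prod_congr rfl fun k _ => ?_
      rw [Real.rpow_logb two_pos (by norm_num) (div_pos (hqk k) (hw k)),
        div_mul_cancel₀ _ (hw k).ne']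
    rcases le_or_gt (n * ε) |S₁ u| with h1 | h1
    · have := hatyp _ h1
      have : (∏ k, q (u k)) * S₁ u ^ 2 / (n * ε) ^ 2 ≤
          ((∏ k, q (u k)) * S₁ u ^ 2 + (∏ k, q (u k)) * S₂ u ^ 2) / (n * ε) ^ 2 := by
        gcongr
        exact le_add_of_nonneg_right (by positivity)
      linarith
    rcases le_or_gt (n * ε) |S₂ u| with h2 | h2
    · have := hatyp _ h2
      have : (∏ k, q (u k)) * S₂ u ^ 2 / (n * ε) ^ 2 ≤
          ((∏ k, q (u k)) * S₁ u ^ 2 + (∏ k, q (u k)) * S₂ u ^ 2) / (n * ε) ^ 2 := by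
        gcongr
        exact le_add_of_nonneg_left (by positivity)
      linarith
    have e1 : S₁ u = ∑ k, Real.logb 2 (q (u k) / p (u k)) - n * D := by
      simp [hS₁, hD, divergence, Finset.sum_sub_distrib]
    have e2 : S₂ u = ∑ k, Real.logb 2 (q (u k) / marginal q (u k).2) + n * H := by
      have : ∑ a : X × Y, q a * Real.logb 2 (q a / marginal q a.2) = -H := (neg_neg _).symm
      simp [hS₂, Finset.sum_add_distrib, this]
    rw [abs_lt] at h1 h2
    by_cases hu : u ∈ C
    · rw [if_pos hu] at t1 ⊢
      rw [if_pos hu]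
      have : ∏ k, q (u k) ≤ 2 ^ (-(n * (H - ε))) * ∏ k, marginal q (u k).2 := by
        rw [hratio (fun a => marginal q a.2) hmk]
        exact mul_le_mul_of_nonneg_right
          (Real.rpow_le_rpow_of_exponent_le one_le_two (by linarith)) hm0
      linarith
    · rw [if_neg hu] at t2 ⊢
      rw [if_neg hu]
      have : ∏ k, q (u k) ≤ 2 ^ (n * (D + ε)) * ∏ k, p (u k) := by
        rw [hratio p hpk]
        exact mul_le_mul_of_nonneg_right
          (Real.rpow_le_rpow_of_exponent_le one_le_two (by linarith)) hp0
      linarith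
  have hsum := Finset.sum_le_sum fun u (_ : u ∈ Finset.univ) => hpoint u
  rw [sum_prod_fin, hq.2, one_pow, Finset.sum_add_distrib, Finset.sum_add_distrib,
    ← Finset.mul_sum, ← Finset.mul_sum, ← Finset.sum_div, Finset.sum_add_distrib,
    sum_prod_mul_sq hq (fun a => Real.logb 2 (q a / p a)),
    sum_prod_mul_sq hq (fun a => Real.logb 2 (q a / marginal q a.2)), ← mul_add] at hsum
  have hB := mul_le_mul_of_nonneg_left (sum_prod_marginal_le hq C hC)
    (show (0 : ℝ) ≤ 2 ^ (-(n * (H - ε))) by positivity)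
  have hV : (n : ℝ) * converseVariance q p / (n * ε) ^ 2 =
      converseVariance q p / (n * ε ^ 2) := by field_simp
  change 1 ≤ _ + _ + (n : ℝ) * converseVariance q p / (n * ε) ^ 2 at hsum
  rw [hV] at hsum
  linarith

/-- The block converse for the event that the first `n` symbols meet their deadlines, none later
than `n + Δ`: the bits sent until then are too few to resolve the typical blocks of `q`. -/
lemma le_sum_errorProb (hp : p ∈ stdSimplex ℝ (X × Y)) (hq : q ∈ stdSimplex ℝ (X × Y))
    (hac : ∀ a, p a = 0 → q a = 0) {R : ℝ} (hR : 0 ≤ R) {Δ : ℕ} (e : Encoder X Y R)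
    (d : Decoder X Y Δ) {n : ℕ} (hn : 0 < n) {ε : ℝ} (hε : 0 < ε) :
    1 - converseVariance q p / (n * ε ^ 2) -
        2 ^ bitBudget R (n + Δ) * 2 ^ (-(n * (condEntropy q - ε))) ≤
      2 ^ (n * (divergence q p + ε)) * ∑ i ∈ Finset.range n, errorProb p e d i := by
  classical
  set L := 1 - converseVariance q p / (n * ε ^ 2) -
        2 ^ bitBudget R (n + Δ) * 2 ^ (-(n * (condEntropy q - ε))) with hL
  set good : (Fin Δ → X × Y) → Set (Fin n → X × Y) := fun v =>
    {u | ∀ i < n, ¬ DecodedWrong e d i (streamExtend (Fin.append u v))} with hgood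
  -- for a fixed future, the good blocks are determined by the side-information and the bits
  have hcount : ∀ v, ∀ y : Fin n → Y, ((Finset.univ.filter fun x : Fin n → X =>
      (fun k => (x k, y k)) ∈ good v).card : ℝ) ≤ 2 ^ bitBudget R (n + Δ) := by
    intro v y
    set ζ : (Fin n → X) → ℕ → X × Y := fun x =>
      streamExtend (Fin.append (fun k => (x k, y k)) v) with hζ
    have hζ2 : ∀ x x' k, (ζ x k).2 = (ζ x' k).2 := by
      intro x x' k
      simp only [hζ, streamExtend]
      split_ifs with h
      · refine Fin.addCases (motive := fun j => (Fin.append (fun k => (x k, y k)) v j).2 =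
          (Fin.append (fun k => (x' k, y k)) v j).2) (fun j => ?_) (fun j => ?_) ⟨k, h⟩
        · simp
        · simp
      · rfl
    have hζ1 : ∀ x (k : Fin n), (ζ x k).1 = x k := by
      intro x k
      have : ζ x k = Fin.append (fun k => (x k, y k)) v (Fin.castAdd Δ k) :=
        streamExtend_apply _ (Fin.castAdd Δ k)
      rw [this, Fin.append_left]
    have hcard : (Finset.univ.filter fun x : Fin n → X => (fun k => (x k, y k)) ∈ good v).card ≤
        (Finset.univ : Finset (List.Vector Bool (bitBudget R (n + Δ)))).card := by
      refine Finset.card_le_card_of_injOn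
        (fun x => ⟨streamBits e (n + Δ) (ζ x), length_streamBits hR e _ _⟩)
        (fun _ _ => Finset.mem_coe.2 (Finset.mem_univ _)) ?_
      intro x hx x' hx' hxx
      have hbits : streamBits e (n + Δ) (ζ x) = streamBits e (n + Δ) (ζ x') :=
        congr_arg Subtype.val hxx
      funext k
      have g := (Finset.mem_filter.1 (Finset.mem_coe.1 hx)).2 k k.2
      have g' := (Finset.mem_filter.1 (Finset.mem_coe.1 hx')).2 k k.2
      have g1 : d k (streamBits e (k + 1 + Δ) (ζ x)) (fun j => (ζ x j).2) = (ζ x k).1 :=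
        not_not.1 g
      have g2 : d k (streamBits e (k + 1 + Δ) (ζ x')) (fun j => (ζ x' j).2) = (ζ x' k).1 :=
        not_not.1 g'
      rw [← hζ1 x k, ← hζ1 x' k, ← g1, ← g2,
        streamBits_eq_of_le hR e (show (k : ℕ) + 1 + Δ ≤ n + Δ by omega) hbits]
      congr 1
      funext j
      exact hζ2 x x' j
    rw [Finset.card_univ, card_vector, Fintype.card_bool] at hcard
    exact_mod_cast hcard
  have hinner : ∀ v : Fin Δ → X × Y, L ≤ 2 ^ (n * (divergence q p + ε)) *
      ∑ u : Fin n → X × Y, if u ∈ good v then 0 else ∏ k, p (u k) := fun v =>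
    block_converse hp hq hac hn hε (good v) (hcount v)
  have hE : ∑ v : Fin Δ → X × Y, (∏ k, p (v k)) *
      ∑ u : Fin n → X × Y, (if u ∈ good v then 0 else ∏ k, p (u k)) ≤
        ∑ i ∈ Finset.range n, errorProb p e d i := by
    calc _ = streamExpect p (n + Δ) (fun z => if ∀ i < n, ¬ DecodedWrong e d i z
          then 0 else 1) := by
          rw [streamExpect_eq_sum, ← (Fin.appendEquiv n Δ).sum_comp, Fintype.sum_prod_type_right]
          refine Finset.sum_congr rfl fun v _ => ?_
          rw [Finset.mul_sum]
          refine Finset.sum_congr rfl fun u _ => ?_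
          change _ = (∏ k, p (Fin.append u v k)) * _
          rw [Fin.prod_univ_add]
          simp only [Fin.append_left, Fin.append_right]
          have hiff : (∀ i < n, ¬ DecodedWrong e d i (streamExtend (Fin.appendEquiv n Δ (u, v)))) ↔
              u ∈ good v := Iff.rfl
          by_cases hu : u ∈ good v
          · rw [if_pos hu, if_pos (hiff.2 hu)]; ring
          · rw [if_neg hu, if_neg (hiff.not.2 hu)]; ring
      _ ≤ streamExpect p (n + Δ) (fun z => ∑ i ∈ Finset.range n, errorIndicator e d i z) := by
          refine streamExpect_mono hp _ fun z => ?_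
          have h0 : ∀ i, 0 ≤ errorIndicator e d i z := fun i => by
            unfold errorIndicator; split_ifs <;> norm_num
          split_ifs with h
          · exact Finset.sum_nonneg fun i _ => h0 i
          · push Not at h
            obtain ⟨i, hi, hw⟩ := h
            have h1 : errorIndicator e d i z = 1 := if_pos hw
            rw [← h1]
            exact Finset.single_le_sum (f := fun i => errorIndicator e d i z) (fun j _ => h0 j)
              (Finset.mem_range.2 hi)
      _ = _ := by
          rw [streamExpect_sum]
          refine Finset.sum_congr rfl fun i hi => ?_
          rw [errorProb_eq_streamExpect]
          have := Finset.mem_range.1 hi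
          exact streamExpect_of_dependsOn hp (by omega) (errorIndicator_dependsOn e d i)
  calc L = ∑ v : Fin Δ → X × Y, (∏ k, p (v k)) * L := by
        rw [← Finset.sum_mul, sum_prod_fin, hp.2, one_pow, one_mul]
    _ ≤ ∑ v : Fin Δ → X × Y, (∏ k, p (v k)) * (2 ^ (n * (divergence q p + ε)) *
          ∑ u : Fin n → X × Y, if u ∈ good v then 0 else ∏ k, p (u k)) :=
        Finset.sum_le_sum fun v _ => mul_le_mul_of_nonneg_left (hinner v)
          (Finset.prod_nonneg fun k _ => hp.1 _)
    _ = 2 ^ (n * (divergence q p + ε)) * ∑ v : Fin Δ → X × Y, (∏ k, p (v k)) *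
          ∑ u : Fin n → X × Y, (if u ∈ good v then 0 else ∏ k, p (u k)) := by
        rw [Finset.mul_sum]
        exact Finset.sum_congr rfl fun v _ => by ring
    _ ≤ _ := mul_le_mul_of_nonneg_left hE (by positivity)

/-- The uncertainty-focusing converse: `n` symbols drawn from `q` need more bits than can be sent
until time `n + Δ`, `Δ ≈ αn`, so that some error has probability about `2^{-n D(q‖p)}`. -/
lemma le_of_isAchievable (hp : p ∈ stdSimplex ℝ (X × Y)) (hq : q ∈ stdSimplex ℝ (X × Y))
    (hac : ∀ a, p a = 0 → q a = 0) {R α : ℝ} (hR : 0 ≤ R) (hα : 0 < α)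
    (hH : (α + 1) * R < condEntropy q) {E : EReal} (hE : IsAchievable p R E) :
    E ≤ ((1 / α * divergence q p : ℝ) : EReal) := by
  by_contra hcon
  obtain ⟨s, hs1, hs2⟩ := EReal.lt_iff_exists_real_btwn.1 (not_le.1 hcon)
  rw [EReal.coe_lt_coe_iff] at hs1
  obtain ⟨e, d, hed⟩ := hE
  obtain ⟨K, hK⟩ := hed s hs2
  have hD0 := divergence_nonneg hq hp hac
  set D := divergence q p with hD
  set H := condEntropy q with hHd
  have hs0 : 0 < s := lt_of_le_of_lt (by positivity) hs1
  have hη : 0 < α * s - D := by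
    rw [one_div_mul_eq_div, div_lt_iff₀ hα] at hs1; linarith
  set ε := min ((α * s - D) / 2) ((H - (α + 1) * R) / 2) with hεd
  have hε : 0 < ε := lt_min (by linarith) (by linarith)
  have hε1 : ε ≤ (α * s - D) / 2 := min_le_left _ _
  have hε2 : ε ≤ (H - (α + 1) * R) / 2 := min_le_right _ _
  have hr0 : (0 : ℝ) < 2 ^ (-ε) := by positivity
  have hr1 : (2 : ℝ) ^ (-ε) < 1 := Real.rpow_lt_one_of_one_lt_of_neg one_lt_two (by linarith)
  have hpow : ∀ n : ℕ, ((2 : ℝ) ^ (-ε)) ^ n = 2 ^ (-ε * n) := fun n => by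
    rw [Real.rpow_mul_natCast zero_le_two]
  have l1 : Tendsto (fun n : ℕ => converseVariance q p / (n * ε ^ 2)) atTop (𝓝 0) :=
    tendsto_const_nhds.div_atTop
      (tendsto_natCast_atTop_atTop.atTop_mul_const (by positivity))
  have l2 := tendsto_pow_atTop_nhds_zero_of_lt_one hr0.le hr1
  have l3 : Tendsto (fun n : ℕ => |K| * 2 ^ s * (n * ((2 : ℝ) ^ (-ε)) ^ n)) atTop (𝓝 0) := by
    simpa using (tendsto_self_mul_const_pow_of_lt_one hr0.le hr1).const_mul (|K| * 2 ^ s)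
  have h4 : (0 : ℝ) < 1 / 4 := by norm_num
  obtain ⟨n, ⟨⟨⟨h1, h2⟩, h3⟩, hn0⟩, hn1⟩ := ((((l1.eventually (gt_mem_nhds h4)).and
    (l2.eventually (gt_mem_nhds h4))).and (l3.eventually (gt_mem_nhds h4))).and
      (eventually_gt_atTop 0)).and (eventually_ge_atTop ⌈1 / α⌉₊) |>.exists
  have hn0' : (0 : ℝ) < n := by exact_mod_cast hn0
  set Δ := ⌊α * n⌋₊ with hΔ
  have hΔ0 : 0 < Δ := by
    rw [hΔ, Nat.floor_pos]
    have := Nat.ceil_le.1 hn1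
    rwa [div_le_iff₀ hα, mul_comm] at this
  have hΔle : (Δ : ℝ) ≤ α * n := Nat.floor_le (by positivity)
  have hΔge : α * n - 1 < Δ := Nat.sub_one_lt_floor _
  have hmain := le_sum_errorProb hp hq hac hR (e Δ) (d Δ) hn0 hε
  have hbits : (2 : ℝ) ^ bitBudget R (n + Δ) * 2 ^ (-(n * (H - ε))) ≤ ((2 : ℝ) ^ (-ε)) ^ n := by
    rw [hpow, ← Real.rpow_natCast, ← Real.rpow_add two_pos]
    refine Real.rpow_le_rpow_of_exponent_le one_le_two ?_
    have b1 := bitBudget_le hR (n + Δ)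
    push_cast at b1
    have b2 : ((n : ℝ) + Δ) * R ≤ (n + α * n) * R := by gcongr
    have b3 : (n : ℝ) * (2 * ε) ≤ n * (H - (α + 1) * R) :=
      mul_le_mul_of_nonneg_left (by linarith) hn0'.le
    linarith
  have herr : 2 ^ (n * (D + ε)) * ∑ i ∈ Finset.range n, errorProb p (e Δ) (d Δ) i ≤
      |K| * 2 ^ s * (n * ((2 : ℝ) ^ (-ε)) ^ n) := by
    have hi : ∀ i ∈ Finset.range n, errorProb p (e Δ) (d Δ) i ≤
        |K| * (2 : ℝ) ^ (-(Δ : ℝ) * s) := fun i _ =>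
      (hK i Δ hΔ0).trans (mul_le_mul_of_nonneg_right (le_abs_self K) (by positivity))
    have hsum := Finset.sum_le_sum hi
    rw [Finset.sum_const, Finset.card_range, nsmul_eq_mul] at hsum
    have hx : (2 : ℝ) ^ (n * (D + ε)) * 2 ^ (-(Δ : ℝ) * s) ≤ 2 ^ s * 2 ^ (-ε * n) := by
      rw [← Real.rpow_add two_pos, ← Real.rpow_add two_pos]
      refine Real.rpow_le_rpow_of_exponent_le one_le_two ?_
      have c1 : (n : ℝ) * (2 * ε) ≤ n * (α * s - D) :=
        mul_le_mul_of_nonneg_left (by linarith) hn0'.le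
      have c2 := mul_le_mul_of_nonneg_right hΔge.le hs0.le
      linarith
    calc _ ≤ 2 ^ (n * (D + ε)) * (n * (|K| * (2 : ℝ) ^ (-(Δ : ℝ) * s))) :=
          mul_le_mul_of_nonneg_left hsum (by positivity)
      _ = n * |K| * (2 ^ (n * (D + ε)) * 2 ^ (-(Δ : ℝ) * s)) := by ring
      _ ≤ n * |K| * (2 ^ s * 2 ^ (-ε * n)) :=
          mul_le_mul_of_nonneg_left hx (by positivity)
      _ = _ := by rw [hpow]; ring
  linarith

lemma reliability_le_focusingBound (hp : IsSource p) {R : ℝ} (hR : 0 < R) :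
    reliability p R ≤ focusingBound p R := by
  refine sSup_le fun E hE => le_focusingBound fun α hα q hq hH hac => ?_
  -- the converse needs a strict inequality: approach `α` from below
  have hβ : ∀ β, 0 < β → β < α → E ≤ ((1 / β * divergence q p : ℝ) : EReal) := fun β h0 h1 =>
    le_of_isAchievable hp.1 hq hac hR.le h0 (by nlinarith) hE
  have hlim : Tendsto (fun β : ℝ => ((1 / β * divergence q p : ℝ) : EReal)) (𝓝[<] α)
      (𝓝 ((1 / α * divergence q p : ℝ) : EReal)) := by
    refine (continuous_coe_real_ereal.tendsto _).comp (Tendsto.mono_left ?_ nhdsWithin_le_nhds)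
    exact ((continuousAt_const.div continuousAt_id hα.ne').mul continuousAt_const).tendsto
  refine ge_of_tendsto hlim ?_
  have hpos : ∀ᶠ β in 𝓝[<] α, 0 < β := nhdsWithin_le_nhds (lt_mem_nhds hα)
  filter_upwards [hpos, self_mem_nhdsWithin] with β h0 h1 using hβ β h0 h1

lemma isAchievable_focusingBound [DecidableEq X] [DecidableEq Y] (hp : IsSource p) {R : ℝ}
    (hR : condEntropy p < R) : IsAchievable p R (focusingBound p R) :=
  ⟨_, _, achieves_typeCode_sqrt hp hR⟩

lemma reliability_eq_focusingBound [DecidableEq X] [DecidableEq Y] (hp : IsSource p) {R : ℝ}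
    (hR : condEntropy p < R) : reliability p R = focusingBound p R :=
  le_antisymm (reliability_le_focusingBound hp ((condEntropy_nonneg hp.1.1).trans_lt hR))
    (le_sSup (isAchievable_focusingBound hp hR))

lemma isAchievable_zero (hp : IsSource p) (R : ℝ) : IsAchievable p R 0 := by
  refine ⟨fun _ _ _ _ _ => false, fun _ _ _ _ => Classical.arbitrary X, fun s hs => ⟨1, ?_⟩⟩
  intro i Δ _
  have hs' : s < 0 := by exact_mod_cast hs
  rw [one_mul]
  exact (errorProb_le_one hp.1 _ _ i).trans (Real.one_le_rpow one_le_two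
    (mul_nonneg_of_nonpos_of_nonpos (neg_nonpos.2 (Nat.cast_nonneg _)) hs'.le))

/-- Below the conditional entropy no positive exponent is achievable: no change of measure is
needed. -/
lemma reliability_eq_zero_of_lt (hp : IsSource p) {R : ℝ} (h0 : 0 ≤ R)
    (hR : R < condEntropy p) : reliability p R = 0 := by
  refine le_antisymm (sSup_le fun E hE => ?_) (le_sSup (isAchievable_zero hp R))
  have key : ∀ α : ℝ, 0 < α → (α + 1) * R < condEntropy p → E ≤ 0 := fun α hα hH => by
    simpa [divergence_self] using le_of_isAchievable hp.1 hp.1 (fun a h => h) h0 hα hH hE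
  rcases h0.eq_or_lt with rfl | hR0
  · exact key 1 one_pos (by simpa using hR)
  · have h1 : 0 < (condEntropy p / R - 1) / 2 := by
      have : 1 < condEntropy p / R := (one_lt_div hR0).2 hR
      linarith
    refine key _ h1 ?_
    have : condEntropy p = condEntropy p / R * R := by field_simp
    nlinarith

end

end SourceCoding

end

open SourceCoding
theorem theorem2 {X Y : Type*} [Fintype X] [Fintype Y] [DecidableEq X] [DecidableEq Y]
    [Nonempty X] [Nonempty Y] :
    -- the error exponent, its parametric form, and its behaviour near the conditional entropy
    (∀ p : X × Y → ℝ, IsSource p →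
      -- the best fixed-delay exponent is the uncertainty-focusing bound, and it is attained
      (∀ R : ℝ, condEntropy p < R → R < Real.logb 2 (Fintype.card X) →
        reliability p R = focusingBound p R ∧ IsAchievable p R (focusingBound p R)) ∧
      -- parametric form
      (∀ ρ : ℝ, 0 < ρ → condEntropy p < gallager p ρ / ρ →
        focusingBound p (gallager p ρ / ρ) = ((gallager p ρ : ℝ) : EReal)) ∧
      (∀ R : ℝ, condEntropy p < R → R < Real.logb 2 (maxSupport p) →
        ∃! ρ : ℝ, 0 < ρ ∧ R = gallager p ρ / ρ) ∧
      (∀ R : ℝ, condEntropy p < R → Real.logb 2 (maxSupport p) ≤ R → focusingBound p R = ⊤) ∧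
      -- slope at the conditional entropy
      (gallagerSecond p ≠ 0 →
        0 < 2 * condEntropy p / gallagerSecond p ∧
        focusingBound p (condEntropy p) = 0 ∧
        (∀ᶠ R in 𝓝[>] (condEntropy p), focusingBound p R ≠ ⊤) ∧
        HasDerivWithinAt (fun R => (focusingBound p R).toReal)
          (2 * condEntropy p / gallagerSecond p) (Set.Ici (condEntropy p)) (condEntropy p)) ∧
      -- jump from zero to infinity
      (gallagerSecond p = 0 →
        (∀ R : ℝ, 0 ≤ R → R < condEntropy p → reliability p R = 0 ∧ focusingBound p R = 0) ∧
        (∀ R : ℝ, condEntropy p < R → reliability p R = ⊤ ∧ focusingBound p R = ⊤))) ∧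
    -- universal achievability: encoder and decoder know the alphabets, the rate and the
    -- block-length, but not the law of the source; the encoder does not know the delay
    (∀ R : ℝ, ∃ d : ℕ → (Δ : ℕ) → Decoder X Y Δ,
      -- a fixed, sufficiently large block-length comes arbitrarily close to the bound
      (∀ p : X × Y → ℝ, IsSource p → condEntropy p < R → R < Real.logb 2 (Fintype.card X) →
        ∀ s : ℝ, (s : EReal) < focusingBound p R → ∃ N₀ : ℕ, ∀ N : ℕ, N₀ ≤ N →
          ∃ K : ℝ, ∀ i Δ : ℕ, 0 < Δ →
            errorProb p (fifoEncoder (typeCode N) R) (d N Δ) i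
              ≤ K * (2 : ℝ) ^ (-(Δ : ℝ) * s)) ∧
      -- a block-length that grows more slowly than the delay achieves it, for all sources at once
      (∃ N : ℕ → ℕ, Filter.Tendsto N Filter.atTop Filter.atTop ∧
        Filter.Tendsto (fun Δ : ℕ => (N Δ : ℝ) / Δ) Filter.atTop (𝓝 0) ∧
        ∀ p : X × Y → ℝ, IsSource p → condEntropy p < R → R < Real.logb 2 (Fintype.card X) →
          Achieves p R (fun Δ => fifoEncoder (typeCode (N Δ)) R) (fun Δ => d (N Δ) Δ)
            (focusingBound p R))) := by
  refine ⟨fun p hp => ⟨fun R hR _ => ⟨reliability_eq_focusingBound hp hR,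
    isAchievable_focusingBound hp hR⟩, fun ρ hρ h => focusingBound_gallager_div hp hρ h,
    fun R hR hM => existsUnique_gallager_div_eq hp hR hM,
    fun R hR hM => focusingBound_eq_top hp hR hM, fun h => ?_, fun h => ?_⟩, fun R => ?_⟩
  · have h2 : 0 < gallagerSecond p := (gallagerSecond_nonneg hp).lt_of_ne h.symm
    have hH := condEntropy_pos_of_gallagerSecond_pos hp h2
    exact ⟨by positivity, focusingBound_condEntropy hp h2, eventually_focusingBound_ne_top hp h2,
      hasDerivWithinAt_focusingBound hp h2⟩
  · refine ⟨fun R h0 hR => ⟨reliability_eq_zero_of_lt hp h0 hR,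
      focusingBound_eq_zero_of_lt hp h0 hR⟩, fun R hR => ?_⟩
    have htop : focusingBound p R = ⊤ := focusingBound_eq_top hp hR
      ((condEntropy_eq_of_gallagerSecond_eq_zero hp h).symm.le.trans hR.le)
    exact ⟨(reliability_eq_focusingBound hp hR).trans htop, htop⟩
  · exact ⟨fun N Δ => fifoDecoder (typeCode N) R Δ,
      fun p hp hR _ s hs => exists_errorProb_typeCode_le_of_fixed hp hR hs,
      Nat.sqrt, tendsto_sqrt_atTop, tendsto_sqrt_div,
      fun p hp hR _ => achieves_typeCode_sqrt hp hR⟩
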